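/- **Conventions.** An abstract multi-graph $G=(V,E,r)$ consists of a set $V$ of vertices, a set $E$ of edges and a map $r$ assigning to each edge the set $r(e)=\{x,y\}$ of its end vertices ($x=y$ is allowed, as are parallel edges). It is finite if $V$ and $E$ are finite, connected if $V\neq\emptyset$ and any two vertices are joined by a finite path, and trivial if it has exactly one vertex and no edges. $G$ is regarded as the poset $V\sqcup E$ in which $x<e$ iff $x\in V$, $e\in E$ and $x\in r(e)$. A closed surface is a compact Hausdorff topological $2$-manifold without boundary (not necessarily orientable), and a flow $v$ on it is a continuous $\mathbb{R}$-action. A point $x$ is singular if $v_t(x)=x$ for all $t$, and periodic if there is $T>0$ with $v_T(x)=x$ and $v_t(x)\neq x$ for $0<t<T$; $\mathrm{Per}(v)$ is the set of periodic points. The flow $v$ is non-wandering if for every point $x$, every neighborhood $U$ of $x$ and every $N>0$ there is $t$ with $|t|>N$ and $v_t(U)\cap U\neq\emptyset$. $\mathrm{LD}$ is the union of the orbits whose closure has nonempty interior. A $k$-saddle ($k\in\mathbb{Z}_{\geq 0}$) is an isolated singular point $p$ with exactly $2k+2$ separatrices counted with multiplicity, i.e. the number of regular (non-singular) orbits with $\omega$-limit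 set $\{p\}$ plus the number of regular orbits with $\alpha$-limit set $\{p\}$ is $2k+2$; a multi-saddle is a $k$-saddle for some $k\geq 0$. The multi-saddle connection diagram $D$ is the union of all multi-saddles and all regular orbits whose $\alpha$- and $\omega$-limit sets are both multi-saddles; its connected components are the multi-saddle connections. An extended orbit is a multi-saddle connection or an orbit not contained in any multi-saddle connection, and $S/v_{\mathrm{ex}}$ is the quotient space of $S$ by extended orbits. A periodic orbit $O$ has a one-sided neighborhood if it has an open saturated (i.e. consisting of whole orbits) neighborhood $U$ and a homeomorphism from the orbit space $U/v$ to $[0,1)$ that sends $O$ to $0$; $N$ is the union of such periodic orbits. On $S/v_{\mathrm{ex}}$, put $O_{\mathrm{ex}}\sim_E O'_{\mathrm{ex}}$ if $O_{\mathrm{ex}}=O'_{\mathrm{ex}}$ or both are contained in the same connected component of $\mathrm{LD}\cup(\mathrm{Per}(v)\setminus N)$. The quotient space $(S/v_{\mathrm{ex}})/{\sim_E}$ carries the quotient topology and its specialization order: $a\leq b$ iff $a\in\overline{\{b\}}$. **Theorem.** For every non-trivial connected finite abstract multi-graph $G$ there is a non-wandering flow $v$ on a connected closed surface $S$ such that $G$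 is isomorphic to $(S/v_{\mathrm{ex}})/{\sim_E}$, i.e. there is a bijection from the poset $V\sqcup E$ of $G$ onto $(S/v_{\mathrm{ex}})/{\sim_E}$ that is an isomorphism for the poset order of $G$ and the specialization order. -/

import Mathlib

open Set Filter Topology

namespace SurfaceFlow

/-! ### Finite abstract multi-graphs (Mathlib's `Graph`: loops and parallel edges allowed) -/

section Multigraph

variable {α β : Type*}

/-- A multi-graph is connected if it has a vertex and any two vertices are joined by a finite
sequence of consecutively adjacent vertices. -/
def GraphConnected (G : Graph α β) : Prop :=
  G.vertexSet.Nonempty ∧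
    ∀ x ∈ G.vertexSet, ∀ y ∈ G.vertexSet, Relation.ReflTransGen G.Adj x y

/-- A multi-graph is trivial if it has exactly one vertex and no edges. -/
def GraphTrivial (G : Graph α β) : Prop :=
  (∃ x, G.vertexSet = {x}) ∧ G.edgeSet = ∅

/-- The underlying set `V ⊔ E` of the poset associated with a multi-graph. -/
inductive Cell (G : Graph α β) : Type _
  | vertex (x : G.vertexSet) : Cell G
  | edge (e : G.edgeSet) : Cell G

/-- The order of the poset `V ⊔ E`: besides reflexivity, `x < e` iff the vertex `x` is an end of
the edge `e`. -/
inductive CellLE (G : Graph α β) : Cell G → Cell G → Prop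
  | refl (a : Cell G) : CellLE G a a
  | inc (x : G.vertexSet) (e : G.edgeSet) (h : G.Inc e.1 x.1) : CellLE G (.vertex x) (.edge e)

instance (G : Graph α β) : PartialOrder (Cell G) where
  le := CellLE G
  le_refl := CellLE.refl
  le_trans := by
    intro a b c hab hbc
    cases hab with
    | refl => exact hbc
    | inc x e h =>
      cases hbc with
      | refl => exact CellLE.inc x e h
  le_antisymm := by
    intro a b hab hba
    cases hab with
    | refl => rfl
    | inc x e h => cases hba

end Multigraph

/-- The specialization order of a topological space: `x ≤ y` iff `x` lies in the closure of
`{y}`. -/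
def SpecOrder (X : Type*) [TopologicalSpace X] (x y : X) : Prop :=
  x ∈ closure ({y} : Set X)

/-- A closed surface: a compact Hausdorff space locally homeomorphic to the Euclidean plane
(hence a compact surface with empty boundary). It is not required to be orientable. -/
structure IsClosedSurface (S : Type*) [TopologicalSpace S] : Prop where
  t2 : T2Space S
  compact : CompactSpace S
  charted : Nonempty (ChartedSpace (EuclideanSpace ℝ (Fin 2)) S)

/-! ### Points and orbits of a flow -/

variable {S : Type*} [TopologicalSpace S]

/-- The set of singular points. -/
def singSet (v : Flow ℝ S) : Set S := {x | ∀ t : ℝ, v t x = x}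

/-- The set of periodic points. -/
def perSet (v : Flow ℝ S) : Set S :=
  {x | ∃ T : ℝ, 0 < T ∧ v T x = x ∧ ∀ t ∈ Ioo 0 T, v t x ≠ x}

/-- A flow is non-wandering if every point is non-wandering. -/
def IsNonWandering (v : Flow ℝ S) : Prop :=
  ∀ x : S, ∀ U ∈ 𝓝 x, ∀ N : ℝ, 0 < N → ∃ t : ℝ, N < |t| ∧ (v t '' U ∩ U).Nonempty

/-- The omega limit set of a point. -/
def omegaSet (v : Flow ℝ S) (x : S) : Set S := omegaLimit atTop v {x}

/-- The alpha limit set of a point. -/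
def alphaSet (v : Flow ℝ S) (x : S) : Set S := omegaLimit atBot v {x}

/-- The union of the locally dense orbits. -/
def locallyDenseSet (v : Flow ℝ S) : Set S :=
  {x | (interior (closure (v.orbit x))).Nonempty}

/-! ### Multi-saddles, the multi-saddle connection diagram and extended orbits

The boundary of a closed surface is empty, so every multi-saddle on it is a `k`-saddle. -/

/-- The regular orbits whose omega limit set is `{x}`. -/
def incomingSeparatrices (v : Flow ℝ S) (x : S) : Set (Set S) :=
  {O | ∃ y, y ∉ singSet v ∧ omegaSet v y = {x} ∧ O = v.orbit y}

/-- The regular orbits whose alpha limit set is `{x}`. -/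
def outgoingSeparatrices (v : Flow ℝ S) (x : S) : Set (Set S) :=
  {O | ∃ y, y ∉ singSet v ∧ alphaSet v y = {x} ∧ O = v.orbit y}

/-- A `k`-saddle: an isolated singular point with exactly `2k + 2` separatrices, counted with
multiplicity (a homoclinic separatrix counts twice). -/
def IsKSaddle (v : Flow ℝ S) (k : ℕ) (x : S) : Prop :=
  x ∈ singSet v ∧ (∃ U ∈ 𝓝 x, U ∩ singSet v = {x}) ∧
    (incomingSeparatrices v x).encard + (outgoingSeparatrices v x).encard
      = ((2 * k + 2 : ℕ) : ℕ∞)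

/-- A multi-saddle: a `k`-saddle for some `k ≥ 0`. -/
def IsMultiSaddle (v : Flow ℝ S) (x : S) : Prop := ∃ k : ℕ, IsKSaddle v k x

/-- The multi-saddle connection diagram: the union of the multi-saddles and of the separatrices
connecting multi-saddles. -/
def diagram (v : Flow ℝ S) : Set S :=
  {x | IsMultiSaddle v x} ∪
    {x | x ∉ singSet v ∧ ∃ p q, IsMultiSaddle v p ∧ IsMultiSaddle v q ∧
      alphaSet v x = {p} ∧ omegaSet v x = {q}}

open Classical in
/-- The extended orbit of a point: its multi-saddle connection (a connected component of the
multi-saddle connection diagram) if it lies in the diagram, and its orbit otherwise. -/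
noncomputable def extOrbit (v : Flow ℝ S) (x : S) : Set S :=
  if x ∈ diagram v then connectedComponentIn (diagram v) x else v.orbit x

/-- Two points are equivalent if they have the same extended orbit. -/
noncomputable def extSetoid (v : Flow ℝ S) : Setoid S := Setoid.ker (extOrbit v)

/-- The extended orbit space `S / v_ex`, with the quotient topology. -/
abbrev ExtOrbitSpace (v : Flow ℝ S) : Type _ := Quotient (extSetoid v)

/-- The extended orbit, as a subset of the surface, that is given by a point of `S / v_ex`. -/
def fiber (v : Flow ℝ S) (a : ExtOrbitSpace v) : Set S :=
  {x | (Quotient.mk (extSetoid v) x) = a}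

theorem fiber_nonempty (v : Flow ℝ S) (a : ExtOrbitSpace v) : (fiber v a).Nonempty :=
  Quotient.exists_rep a

/-! ### Collapsing the edges -/

/-- The orbit space `S / v`, with the quotient topology. -/
abbrev OrbitSpace (v : Flow ℝ S) : Type _ := Quotient (Setoid.ker v.orbit)

/-- The projection onto the orbit space. -/
def orbitProj (v : Flow ℝ S) (x : S) : OrbitSpace v := Quotient.mk _ x

/-- The orbit of `x` has a one-sided neighborhood: it has an open saturated neighborhood `U`
and a homeomorphism from `U / v` (the open subspace of `S / v` that `U` projects onto) to
`[0, 1)` that sends the orbit of `x` to `0`. -/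
def HasOneSidedNhd (v : Flow ℝ S) (x : S) : Prop :=
  ∃ U : Set S, IsOpen U ∧ IsInvariant v U ∧ ∃ hx : x ∈ U,
    ∃ h : (orbitProj v '' U) ≃ₜ Ico (0 : ℝ) 1,
      (h ⟨orbitProj v x, mem_image_of_mem _ hx⟩ : ℝ) = 0

/-- The union `N` of the periodic orbits with one-sided neighborhoods. -/
def oneSidedSet (v : Flow ℝ S) : Set S := {x | x ∈ perSet v ∧ HasOneSidedNhd v x}

/-- The set `LD ⊔ (Per(v) - N)`. -/
def edgeRegion (v : Flow ℝ S) : Set S := locallyDenseSet v ∪ (perSet v \ oneSidedSet v)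

/-- The relation `∼_E` on `S / v_ex`: two extended orbits are equivalent if they are equal or
contained in the same connected component of `LD ⊔ (Per(v) - N)`. -/
def collapseSetoid (v : Flow ℝ S) : Setoid (ExtOrbitSpace v) where
  r a b := a = b ∨ ∃ z ∈ edgeRegion v,
    fiber v a ⊆ connectedComponentIn (edgeRegion v) z ∧
    fiber v b ⊆ connectedComponentIn (edgeRegion v) z
  iseqv :=
    { refl := fun _ => Or.inl rfl
      symm := by
        rintro a b (h | ⟨z, hz, h1, h2⟩)
        · exact Or.inl h.symm
        · exact Or.inr ⟨z, hz, h2, h1⟩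
      trans := by
        rintro a b c (rfl | ⟨z, hz, h1, h2⟩) hbc
        · exact hbc
        · rcases hbc with rfl | ⟨w, hw, h3, h4⟩
          · exact Or.inr ⟨z, hz, h1, h2⟩
          · obtain ⟨y, hy⟩ := fiber_nonempty v b
            refine Or.inr ⟨z, hz, h1, ?_⟩
            rw [connectedComponentIn_eq (h2 hy), ← connectedComponentIn_eq (h3 hy)]
            exact h4 }

/-- The space `(S / v_ex) / ∼_E`, with the quotient topology. -/
abbrev CollapsedSpace (v : Flow ℝ S) : Type _ := Quotient (collapseSetoid v)

/-- The multi-graph `G` is isomorphic to `(S / v_ex) / ∼_E`: the poset `V ⊔ E` of `G` is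
isomorphic to `(S / v_ex) / ∼_E` with its specialization order. -/
def IsRealizedBy {α β : Type*} (G : Graph α β) (v : Flow ℝ S) : Prop :=
  Nonempty ((fun a b : Cell G => a ≤ b) ≃r SpecOrder (CollapsedSpace v))

end SurfaceFlow

namespace SurfaceFlow

/-! ### Recognizing the collapsed space from a map to the cells -/

section Realization

variable {α β S : Type*} [TopologicalSpace S] {G : Graph α β} {v : Flow ℝ S} {c : S → Cell G}

/-! Each edge becomes a closed annulus foliated by periodic circles, and each vertex becomes a
connected graph of saddle connections made from the boundary circles of the annuli ending there. A
boundary circle is a dart (an edge with a choice of end), and `h` sends it to its end vertex. Choose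
a permutation `σ` of the darts whose cycles are exactly the fibers of `h`, and glue the upper half
of the circle `δ` to the lower half of `σ δ` by `u ↦ -u`. The points `±1` of the circles become
corners, indexed by the cycles of `σ * σ`. Orientations play no role: a fixed point of `σ` glues its
circle to itself antipodally and produces a crosscap.

The flow comes from the linear system `x' = -y`, `y' = t² x` acting on directions, with `t = r (1 -
r)` at height `r`. For `t > 0` it rotates the whole circle periodically; at `t = 0` it is parabolic,
fixes `±1` and moves every other point of the boundary circle between them. It commutes with `u ↦
-u` and depends continuously on `t` up to `t = 0`, so it descends to the glued surface. Every
interior orbit is periodic and these are dense, hence the flow is non-wandering. The arc of `δ` runs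
from the corner of `δ` to that of `σ δ`; a corner with `m` darts has `m` incoming and `m` outgoing
separatrices, so it is an `(m - 1)`-saddle. Thus the diagram is the union of the glued boundary
circles, with one component per vertex (`diagram_eq`, `isPreconnected_cellMap_vertex`), and the edge
region is the union of the open annuli (`edgeRegion_eq`). The closure of an open annulus meets
precisely the components of its ends, which yields the order (`isRealizedBy_of_map`).

That the quotient is a surface is clear except at a corner, where `2 m` half-discs meet: an `m`-th
root shrinks each to an angle `π / m`, and roots of unity place them around the origin
(`exists_chart_corner`). Connectedness of the graph gives connectedness of the surface, and
non-triviality ensures that every vertex has a dart. -/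

theorem mem_extOrbit_self (v : Flow ℝ S) (p : S) : p ∈ extOrbit v p := by
  unfold extOrbit
  split_ifs with h
  · exact mem_connectedComponentIn h
  · exact v.mem_orbit_self p

/-- The vertex fibers partition the diagram into finitely many disjoint closed connected sets, which
are therefore its components. Finiteness is what makes the union of the other fibers closed. -/
theorem extOrbit_eq_of_vertex (hV : G.vertexSet.Finite)
    (hdiag : ∀ p, p ∈ diagram v ↔ ∃ x, c p = .vertex x)
    (hVc : ∀ x, IsClosed (c ⁻¹' {.vertex x})) (hVp : ∀ x, IsPreconnected (c ⁻¹' {.vertex x}))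
    {p : S} {x : G.vertexSet} (hp : c p = .vertex x) : extOrbit v p = c ⁻¹' {.vertex x} := by
  have : Finite G.vertexSet := hV
  have hpd : p ∈ diagram v := (hdiag p).2 ⟨x, hp⟩
  rw [extOrbit, if_pos hpd]
  apply Subset.antisymm
  · have hpre := isPreconnected_iff_subset_of_disjoint_closed.1
      (isPreconnected_connectedComponentIn (x := p) (F := diagram v))
      (c ⁻¹' {.vertex x}) (⋃ y ∈ {y | y ≠ x}, c ⁻¹' {.vertex y}) (hVc x)
      ((toFinite _).isClosed_biUnion fun y _ => hVc y) ?_ ?_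
    · refine hpre.resolve_right fun h => ?_
      have := h (mem_connectedComponentIn hpd)
      simp only [mem_iUnion, mem_preimage, mem_singleton_iff, hp] at this
      obtain ⟨y, hy, h⟩ := this
      cases h
      exact hy rfl
    · intro q hq
      obtain ⟨y, hy⟩ := (hdiag q).1 (connectedComponentIn_subset _ _ hq)
      by_cases hyx : y = x
      · exact Or.inl (by simp [hy, hyx])
      · exact Or.inr (mem_biUnion (show y ∈ {y | y ≠ x} from hyx) hy)
    · rw [eq_empty_iff_forall_notMem]
      rintro q ⟨-, hq, hq'⟩
      simp only [mem_iUnion, mem_preimage, mem_singleton_iff] at hq hq'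
      obtain ⟨y, hy, h⟩ := hq'
      rw [hq] at h
      cases h
      exact hy rfl
  · exact (hVp x).subset_connectedComponentIn hp fun q hq => (hdiag q).2 ⟨x, hq⟩

theorem extOrbit_eq_of_edge (hdiag : ∀ p, p ∈ diagram v ↔ ∃ x, c p = .vertex x)
    {p : S} {e : G.edgeSet} (hp : c p = .edge e) : extOrbit v p = v.orbit p := by
  refine if_neg fun h => ?_
  obtain ⟨x, hx⟩ := (hdiag p).1 h
  rw [hp] at hx
  cases hx

/-- The counterpart for edges: these fibers are open, so no finiteness is needed to separate one
from the rest. -/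
theorem connectedComponentIn_edgeRegion (hedge : ∀ p, p ∈ edgeRegion v ↔ ∃ e, c p = .edge e)
    (hEo : ∀ e, IsOpen (c ⁻¹' {.edge e})) (hEp : ∀ e, IsPreconnected (c ⁻¹' {.edge e}))
    {p : S} {e : G.edgeSet} (hp : c p = .edge e) :
    connectedComponentIn (edgeRegion v) p = c ⁻¹' {.edge e} := by
  have hpd : p ∈ edgeRegion v := (hedge p).2 ⟨e, hp⟩
  apply Subset.antisymm
  · refine (isPreconnected_connectedComponentIn (x := p) (F := edgeRegion v)).subset_left_of_subset_union
      (hEo e) (isOpen_biUnion (s := {e' | e' ≠ e}) fun e' _ => hEo e') ?_ ?_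
      ⟨p, mem_connectedComponentIn hpd, hp⟩
    · rw [Set.disjoint_left]
      intro q hq hq'
      simp only [mem_iUnion, mem_preimage, mem_singleton_iff] at hq hq'
      obtain ⟨y, hy, h⟩ := hq'
      rw [hq] at h
      cases h
      exact hy rfl
    · intro q hq
      obtain ⟨y, hy⟩ := (hedge q).1 (connectedComponentIn_subset _ _ hq)
      by_cases hyx : y = e
      · exact Or.inl (by simp [hy, hyx])
      · exact Or.inr (mem_biUnion (show y ∈ {y | y ≠ e} from hyx) hy)
  · exact (hEp e).subset_connectedComponentIn hp fun q hq => (hedge q).2 ⟨e, hq⟩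

/-- The projection of the surface onto the collapsed extended orbit space. -/
noncomputable def collapseProj (v : Flow ℝ S) (p : S) : CollapsedSpace v :=
  Quotient.mk _ (Quotient.mk (extSetoid v) p)

theorem isQuotientMap_collapseProj (v : Flow ℝ S) : IsQuotientMap (collapseProj v) :=
  (isQuotientMap_quotient_mk' (s := collapseSetoid v)).comp
    (isQuotientMap_quotient_mk' (s := extSetoid v))

/-- A map from the surface to the cells of a multi-graph, whose fibers are the multi-saddle
connections and the components of the edge region with the appropriate adherences, realizes
the multi-graph. -/
theorem isRealizedBy_of_map (hV : G.vertexSet.Finite) (hsurj : Function.Surjective c)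
    (hdiag : ∀ p, p ∈ diagram v ↔ ∃ x, c p = .vertex x)
    (hedge : ∀ p, p ∈ edgeRegion v ↔ ∃ e, c p = .edge e)
    (hinv : ∀ t p, c (v t p) = c p)
    (hVc : ∀ x, IsClosed (c ⁻¹' {.vertex x})) (hVp : ∀ x, IsPreconnected (c ⁻¹' {.vertex x}))
    (hEo : ∀ e, IsOpen (c ⁻¹' {.edge e})) (hEp : ∀ e, IsPreconnected (c ⁻¹' {.edge e}))
    (hcl : ∀ e x, G.Inc e.1 x.1 → (c ⁻¹' {.vertex x} ∩ closure (c ⁻¹' {.edge e})).Nonempty)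
    (hclosed : ∀ e, IsClosed (c ⁻¹' {a | a ≤ .edge e})) : IsRealizedBy G v := by
  have hext : ∀ p q, extOrbit v p = extOrbit v q → c p = c q := by
    intro p q h
    have hq : q ∈ extOrbit v p := h ▸ mem_extOrbit_self v q
    cases hp : c p with
    | vertex x =>
      rw [extOrbit_eq_of_vertex hV hdiag hVc hVp hp] at hq
      exact hq.symm
    | edge e =>
      rw [extOrbit_eq_of_edge hdiag hp] at hq
      obtain ⟨t, rfl⟩ := (v.mem_orbit_iff).1 hq
      rw [hinv, hp]
  have hfib : ∀ p e, c p = .edge e → fiber v (Quotient.mk _ p) ⊆ c ⁻¹' {.edge e} := by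
    intro p e hp q hq
    have : extOrbit v q = extOrbit v p := Quotient.exact hq
    simpa [hp] using hext _ _ this
  -- The collapsed space and the set of cells are the same quotient of the surface; only the order
  -- remains to be compared.
  have hκ : ∀ p q, collapseProj v p = collapseProj v q ↔ c p = c q := by
    intro p q
    constructor
    · intro h
      rcases (Quotient.exact h : (collapseSetoid v).r _ _) with h | ⟨z, hz, h1, h2⟩
      · exact hext p q (Quotient.exact h)
      · obtain ⟨e, he⟩ := (hedge z).1 hz
        rw [connectedComponentIn_edgeRegion hedge hEo hEp he] at h1 h2
        have hp : c p = _ := h1 (show p ∈ fiber v _ from rfl)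
        have hq : c q = _ := h2 (show q ∈ fiber v _ from rfl)
        rw [hp, hq]
    · intro h
      apply Quotient.sound
      cases hp : c p with
      | vertex x =>
        left
        apply Quotient.sound
        change extOrbit v p = extOrbit v q
        rw [extOrbit_eq_of_vertex hV hdiag hVc hVp hp,
          extOrbit_eq_of_vertex hV hdiag hVc hVp (h.symm.trans hp)]
      | edge e =>
        right
        refine ⟨p, (hedge p).2 ⟨e, hp⟩, ?_⟩
        rw [connectedComponentIn_edgeRegion hedge hEo hEp hp]
        exact ⟨hfib p e hp, hfib q e (h.symm.trans hp)⟩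
  have hIic : ∀ a : Cell G, IsClosed (c ⁻¹' {b | b ≤ a}) := by
    rintro (x | e)
    · have : {b : Cell G | b ≤ .vertex x} = {.vertex x} := by
        ext b
        refine ⟨fun h => ?_, fun h => by simp [show b = _ from h]⟩
        cases (show CellLE G b (.vertex x) from h)
        rfl
      rw [this]
      exact hVc x
    · exact hclosed e
  have hord : ∀ p q, SpecOrder (CollapsedSpace v) (collapseProj v p) (collapseProj v q) ↔
      c p ≤ c q := by
    intro p q
    constructor
    · intro h
      -- A down-set of cells has a saturated preimage, so its image is closed and contains the
      -- closure of the class of `q`.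
      have hpre : collapseProj v ⁻¹' (collapseProj v '' (c ⁻¹' {b | b ≤ c q})) =
          c ⁻¹' {b | b ≤ c q} := by
        refine Subset.antisymm ?_ (subset_preimage_image _ _)
        rintro r ⟨r', hr', hr⟩
        have := (hκ _ _).1 hr
        simpa [this] using hr'
      have hC : IsClosed (collapseProj v '' (c ⁻¹' {b | b ≤ c q})) := by
        rw [← (isQuotientMap_collapseProj v).isClosed_preimage, hpre]
        exact hIic _
      have := closure_minimal (singleton_subset_iff.2
        (mem_image_of_mem (collapseProj v) (show q ∈ c ⁻¹' {b | b ≤ c q} by simp))) hC h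
      exact hpre.subset this
    · intro h
      generalize ha : c p = a at h
      generalize hb : c q = b at h
      cases (show CellLE G a b from h) with
      | refl =>
        rw [SpecOrder, (hκ p q).2 (ha.trans hb.symm)]
        exact subset_closure rfl
      -- One adherent point suffices, since the whole fiber over `x` is a single point of the
      -- quotient.
      | inc x e hxe =>
        obtain ⟨p', hp', h1⟩ := hcl e x hxe
        rw [(hκ p p').2 (ha.trans (show c p' = _ from hp').symm)]
        have h2 := image_closure_subset_closure_image (isQuotientMap_collapseProj v).continuous
          (mem_image_of_mem (collapseProj v) h1)
        refine closure_mono ?_ h2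
        rintro _ ⟨r, hr, rfl⟩
        exact (hκ _ _).2 (hr.trans hb.symm)
  refine ⟨RelIso.ofSurjective
    (⟨⟨fun a => collapseProj v (Function.surjInv hsurj a), fun a b h => ?_⟩, ?_⟩ :
      (fun a b : Cell G => a ≤ b) ↪r SpecOrder (CollapsedSpace v)) ?_⟩
  · have := (hκ _ _).1 h
    rwa [Function.surjInv_eq hsurj, Function.surjInv_eq hsurj] at this
  · intro a b
    change SpecOrder _ (collapseProj v _) (collapseProj v _) ↔ _
    rw [hord, Function.surjInv_eq hsurj, Function.surjInv_eq hsurj]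
  · intro y
    obtain ⟨p, rfl⟩ := (isQuotientMap_collapseProj v).surjective y
    exact ⟨c p, (hκ _ _).2 (Function.surjInv_eq hsurj _)⟩

end Realization

/-! ### Quotients of compact spaces and charts on them -/

section Topology

variable {X S : Type*} [TopologicalSpace X] [TopologicalSpace S]

/-- The saturation of a closed set is the projection, along a compact factor, of a closed part of
the relation. -/
theorem isClosedMap_of_isClosed_ker [CompactSpace X] {π : X → S} (hπ : IsQuotientMap π)
    (hR : IsClosed {p : X × X | π p.1 = π p.2}) : IsClosedMap π := by
  intro C hC
  rw [← hπ.isClosed_preimage]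
  have : π ⁻¹' (π '' C) = Prod.snd '' ({p : X × X | π p.1 = π p.2} ∩ Prod.fst ⁻¹' C) := by
    ext q
    constructor
    · rintro ⟨p, hp, h⟩
      exact ⟨(p, q), ⟨h, hp⟩, rfl⟩
    · rintro ⟨⟨p, q'⟩, ⟨h, hp⟩, rfl⟩
      exact ⟨p, hp, h⟩
  rw [this]
  exact isClosedMap_snd_of_compactSpace _ (hR.inter (hC.preimage continuous_fst))

/-- Two fibers are disjoint closed sets in a normal space. Separating open sets are shrunk to
saturated ones by removing the saturation of their complements. -/
theorem t2Space_of_isClosed_ker [CompactSpace X] [T2Space X] {π : X → S} (hπ : IsQuotientMap π)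
    (hR : IsClosed {p : X × X | π p.1 = π p.2}) : T2Space S := by
  have hcl := isClosedMap_of_isClosed_ker hπ hR
  have hfib : ∀ s, IsClosed (π ⁻¹' {s}) := fun s => by
    obtain ⟨p, rfl⟩ := hπ.surjective s
    have := hcl _ (isClosed_singleton (x := p))
    rw [image_singleton] at this
    exact this.preimage hπ.continuous
  refine ⟨fun s t hst => ?_⟩
  obtain ⟨U, V, hU, hV, hsU, htV, hUV⟩ := normal_separation (hfib s) (hfib t)
    (Disjoint.preimage π (disjoint_singleton.2 hst))
  refine ⟨(π '' Uᶜ)ᶜ, (π '' Vᶜ)ᶜ, (hcl _ hU.isClosed_compl).isOpen_compl,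
    (hcl _ hV.isClosed_compl).isOpen_compl, ?_, ?_, ?_⟩
  · rintro ⟨p, hp, rfl⟩
    exact hp (hsU rfl)
  · rintro ⟨p, hp, rfl⟩
    exact hp (htV rfl)
  · rw [Set.disjoint_left]
    intro r hr hr'
    obtain ⟨p, rfl⟩ := hπ.surjective r
    have h1 : p ∈ U := by_contra fun h => hr ⟨p, h, rfl⟩
    have h2 : p ∈ V := by_contra fun h => hr' ⟨p, h, rfl⟩
    exact Set.disjoint_left.1 hUV h1 h2

/-- Used for the charts: half-discs around all preimages of a glued point together cover a
neighborhood of it. -/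
theorem image_mem_nhds_of_isClosedMap {π : X → S} (hcl : IsClosedMap π) (hs : Function.Surjective π)
    {W : Set X} {s : S} (hW : ∀ p, π p = s → W ∈ 𝓝 p) : π '' W ∈ 𝓝 s := by
  have ho : IsOpen (π '' (interior W)ᶜ)ᶜ := (hcl _ isOpen_interior.isClosed_compl).isOpen_compl
  refine mem_of_superset (ho.mem_nhds ?_) ?_
  · rintro ⟨p, hp, hps⟩
    exact hp (mem_interior_iff_mem_nhds.2 (hW p hps))
  · intro r hr
    obtain ⟨p, rfl⟩ := hs r
    exact mem_image_of_mem π (interior_subset (by_contra fun h => hr ⟨p, h, rfl⟩))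

/-- A point of a Hausdorff space has a chart into another Hausdorff space if a neighborhood of it
and a neighborhood in the model are the same quotient of a compact space. -/
theorem exists_openPartialHomeomorph_of_compact {Z M : Type*} [TopologicalSpace Z] [CompactSpace Z]
    [TopologicalSpace M] [T2Space M] [T2Space S] {g : Z → S} {F : Z → M} (hg : Continuous g)
    (hF : Continuous F) (hgF : ∀ z w, g z = g w ↔ F z = F w) {z₀ : Z} (hgn : range g ∈ 𝓝 (g z₀))
    (hFn : range F ∈ 𝓝 (F z₀)) : ∃ e : OpenPartialHomeomorph S M, g z₀ ∈ e.source := by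
  have hgc : ∀ C : Set Z, IsClosed C → IsClosed (g '' C) :=
    fun _ hC => (hC.isCompact.image hg).isClosed
  have hFc : ∀ C : Set Z, IsClosed C → IsClosed (F '' C) :=
    fun _ hC => (hC.isCompact.image hF).isClosed
  -- `U` and `V` are trimmed so that they come from the same subset of `Z`: the points interior on
  -- both sides.
  set U := interior (range g) ∩ (g '' (F ⁻¹' (interior (range F))ᶜ))ᶜ with hU
  set V := interior (range F) ∩ (F '' (g ⁻¹' (interior (range g))ᶜ))ᶜ with hV
  have hUV : ∀ z, g z ∈ U ↔ F z ∈ V := by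
    intro z
    simp only [hU, hV, mem_inter_iff, mem_compl_iff, mem_image, mem_preimage, not_exists, not_and,
      not_imp_not]
    constructor
    · rintro ⟨h1, h2⟩
      exact ⟨h2 z rfl, fun w hwz => by rwa [(hgF w z).2 hwz]⟩
    · rintro ⟨h1, h2⟩
      exact ⟨h2 z rfl, fun w hwz => by rwa [(hgF w z).1 hwz]⟩
  have hUo : IsOpen U := isOpen_interior.inter
    (hgc _ (isOpen_interior.isClosed_compl.preimage hF)).isOpen_compl
  have hVo : IsOpen V := isOpen_interior.inter
    (hFc _ (isOpen_interior.isClosed_compl.preimage hg)).isOpen_compl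
  have hUr : ∀ s ∈ U, ∃ z, g z = s := fun s hs => mem_range.1 (interior_subset hs.1)
  have hVr : ∀ y ∈ V, ∃ z, F z = y := fun s hs => mem_range.1 (interior_subset hs.1)
  have : Nonempty Z := ⟨z₀⟩
  have hgi : ∀ z, F (Function.invFun g (g z)) = F z := fun z =>
    (hgF _ _).1 (Function.invFun_eq ⟨z, rfl⟩)
  have hFi : ∀ z, g (Function.invFun F (F z)) = g z := fun z =>
    (hgF _ _).2 (Function.invFun_eq ⟨z, rfl⟩)
  refine ⟨⟨⟨⟨fun s => F (Function.invFun g s), fun y => g (Function.invFun F y), U, V, ?_, ?_, ?_, ?_⟩,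
    ?_, ?_⟩, hUo, hVo⟩, ?_⟩
  · intro s hs
    obtain ⟨z, rfl⟩ := hUr s hs
    simpa only [hgi] using (hUV z).1 hs
  · intro y hy
    obtain ⟨z, rfl⟩ := hVr y hy
    simpa only [hFi] using (hUV z).2 hy
  · intro s hs
    obtain ⟨z, rfl⟩ := hUr s hs
    simp only [hgi, hFi]
  · intro y hy
    obtain ⟨z, rfl⟩ := hVr y hy
    simp only [hgi, hFi]
  · rw [continuousOn_iff_isClosed]
    intro C hC
    refine ⟨_, hgc _ (hC.preimage hF), ?_⟩
    ext s
    refine and_congr_left fun hs => ?_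
    obtain ⟨z, rfl⟩ := hUr s hs
    simp only [mem_preimage, hgi, mem_image]
    exact ⟨fun h => ⟨z, h, rfl⟩, fun ⟨w, hw, h⟩ => by rwa [← (hgF w z).1 h]⟩
  · rw [continuousOn_iff_isClosed]
    intro C hC
    refine ⟨_, hFc _ (hC.preimage hg), ?_⟩
    ext s
    refine and_congr_left fun hs => ?_
    obtain ⟨z, rfl⟩ := hVr s hs
    simp only [mem_preimage, hFi, mem_image]
    exact ⟨fun h => ⟨z, h, rfl⟩, fun ⟨w, hw, h⟩ => by rwa [← (hgF w z).2 h]⟩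
  · refine ⟨mem_interior_iff_mem_nhds.2 hgn, ?_⟩
    rintro ⟨w, hw, h⟩
    exact hw (by simpa [(hgF w z₀).1 h] using mem_interior_iff_mem_nhds.2 hFn)

theorem nonempty_chartedSpace_of_complex
    (h : ∀ s : S, ∃ e : OpenPartialHomeomorph S ℂ, s ∈ e.source) :
    Nonempty (ChartedSpace (EuclideanSpace ℝ (Fin 2)) S) := by
  choose e he using h
  let L : ℂ ≃ₜ EuclideanSpace ℝ (Fin 2) :=
    Complex.orthonormalBasisOneI.repr.toHomeomorph
  exact ⟨{
    atlas := range fun s => (e s).trans L.toOpenPartialHomeomorph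
    chartAt := fun s => (e s).trans L.toOpenPartialHomeomorph
    mem_chart_source := fun s => by simp [he s]
    chart_mem_atlas := fun s => mem_range_self s }⟩

/-- A continuous injection of an interval is strictly monotone. This is what later excludes
one-sided neighborhoods. -/
theorem not_exists_interior_min_of_injOn {f : ℝ → ℝ} {a m b : ℝ} (ham : a < m) (hmb : m < b)
    (hf : ContinuousOn f (Icc a b)) (hi : InjOn f (Icc a b)) (ha : f m ≤ f a) (hb : f m ≤ f b) :
    False := by
  have h1 : a ∈ Icc a b := ⟨le_rfl, (ham.trans hmb).le⟩
  have h2 : m ∈ Icc a b := ⟨ham.le, hmb.le⟩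
  have h3 : b ∈ Icc a b := ⟨(ham.trans hmb).le, le_rfl⟩
  rcases ContinuousOn.strictMonoOn_of_injOn_Icc' (ham.trans hmb).le hf hi with h | h
  · exact (h h1 h2 ham).not_ge ha
  · exact (h h2 h3 hmb).not_ge hb

end Topology

/-! ### Limit sets and recurrence of periodic points -/

section LimitSets

variable {S : Type*} [TopologicalSpace S] (v : Flow ℝ S)

theorem omegaLimit_singleton_of_tendsto [T2Space S] {f : Filter ℝ} [f.NeBot] {x p : S}
    (h : Tendsto (fun t => v t x) f (𝓝 p)) : omegaLimit f v {x} = {p} := by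
  ext y
  rw [mem_omegaLimit_singleton_iff_mapClusterPt, mem_singleton_iff]
  constructor
  · intro hy
    have : ClusterPt y (𝓝 p) := hy.clusterPt.mono h
    exact eq_of_nhds_neBot this
  · rintro rfl
    exact h.mapClusterPt

/-- The point returns to itself at all integer multiples of a period. Hence a periodic orbit is
never a separatrix. -/
theorem mem_alphaSet_omegaSet_of_mem_perSet {x : S} (hx : x ∈ perSet v) :
    x ∈ alphaSet v x ∧ x ∈ omegaSet v x := by
  obtain ⟨T, hT, hTx, -⟩ := hx
  have hn : ∀ n : ℕ, v (n * T) x = x := by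
    intro n
    induction n with
    | zero => simp
    | succ n ih => rw [Nat.cast_succ, add_mul, one_mul, v.map_add, hTx, ih]
  have hn' : ∀ n : ℕ, v (-(n * T)) x = x := by
    intro n
    conv_lhs => rw [← hn n]
    rw [← v.map_add, neg_add_cancel, v.map_zero_apply]
  have htend : Tendsto (fun n : ℕ => (n : ℝ) * T) atTop atTop :=
    tendsto_natCast_atTop_atTop.atTop_mul_const hT
  constructor
  · refine (mem_omegaLimit_singleton_iff_mapClusterPt _ _ _ _).2 ?_
    refine MapClusterPt.of_comp (tendsto_neg_atTop_atBot.comp htend) ?_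
    have : ((fun t => v t x) ∘ (Neg.neg ∘ fun n : ℕ => (n : ℝ) * T)) = fun _ => x := funext hn'
    rw [this]
    exact tendsto_const_nhds.mapClusterPt
  · refine (mem_omegaLimit_singleton_iff_mapClusterPt _ _ _ _).2 ?_
    refine MapClusterPt.of_comp htend ?_
    have : ((fun t => v t x) ∘ fun n : ℕ => (n : ℝ) * T) = fun _ => x := funext hn
    rw [this]
    exact tendsto_const_nhds.mapClusterPt

theorem isNonWandering_of_dense_perSet (h : Dense (perSet v)) : IsNonWandering v := by
  intro x U hU N hN
  obtain ⟨y, ⟨T, hT, hTy, -⟩, hy⟩ := h.inter_nhds_nonempty hU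
  have hn : ∀ n : ℕ, v (n * T) y = y := by
    intro n
    induction n with
    | zero => simp
    | succ n ih => rw [Nat.cast_succ, add_mul, one_mul, v.map_add, hTy, ih]
  obtain ⟨n, hn'⟩ := exists_nat_gt (N / T)
  rw [div_lt_iff₀ hT] at hn'
  exact ⟨n * T, hn'.trans_le (le_abs_self _), y, ⟨y, hy, hn n⟩, hy⟩

end LimitSets

/-! ### The family of flows on the circle of directions -/

section CircleFlow

/-- The point of the unit circle in the direction of a nonzero complex number. -/
noncomputable def direction (z : ℂ) : Circle := Circle.exp z.arg

theorem norm_mul_direction (z : ℂ) : (‖z‖ : ℂ) * direction z = z := by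
  rw [direction, Circle.coe_exp, Complex.norm_mul_exp_arg_mul_I]

theorem coe_direction {z : ℂ} (hz : z ≠ 0) : (direction z : ℂ) = z / ‖z‖ := by
  rw [eq_div_iff (by simpa using hz), mul_comm, norm_mul_direction]

theorem direction_eq_of_eq_smul {z : ℂ} {u : Circle} {k : ℝ} (hk : 0 < k) (h : z = k * u) :
    direction z = u := by
  have hz : z ≠ 0 := by
    rw [h]
    exact mul_ne_zero (by exact_mod_cast hk.ne') u.coe_ne_zero
  apply Circle.ext
  have hn : ‖z‖ = k := by rw [h, norm_mul, u.norm_coe, Complex.norm_real, Real.norm_of_nonneg hk.le, mul_one]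
  rw [coe_direction hz, hn, h, mul_div_cancel_left₀ _ (by exact_mod_cast hk.ne')]

theorem direction_coe (u : Circle) : direction u = u :=
  direction_eq_of_eq_smul one_pos (by simp)

theorem direction_smul {z : ℂ} (hz : z ≠ 0) {k : ℝ} (hk : 0 < k) :
    direction (k * z) = direction z :=
  direction_eq_of_eq_smul (mul_pos hk (norm_pos_iff.2 hz)) (by
    conv_lhs => rw [← norm_mul_direction z]
    push_cast
    ring)

theorem direction_neg {z : ℂ} (hz : z ≠ 0) : direction (-z) = -direction z :=
  direction_eq_of_eq_smul (norm_pos_iff.2 hz) (by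
    conv_lhs => rw [← norm_mul_direction z]
    simp)

theorem continuousAt_direction {z : ℂ} (hz : z ≠ 0) : ContinuousAt direction z := by
  have hi : IsInducing (fun u : Circle => (u : ℂ)) := ⟨rfl⟩
  rw [hi.continuousAt_iff]
  have : ContinuousAt (fun w : ℂ => w / ‖w‖) z :=
    continuousAt_id.div (by fun_prop) (by simpa using hz)
  refine this.congr ?_
  filter_upwards [isOpen_ne.mem_nhds hz] with w hw
  exact (coe_direction hw).symm

/-- The off-diagonal coefficient `sin (t s) / t` of the linear flow, equal to `s` for `t = 0`. -/
noncomputable def shearCoeff (t s : ℝ) : ℝ := s * Real.sinc (t * s)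

theorem mul_shearCoeff (t s : ℝ) : t * shearCoeff t s = Real.sin (t * s) := by
  rw [shearCoeff]
  by_cases h : t * s = 0
  · rw [h, ← mul_assoc, h]
    simp
  · rw [Real.sinc_of_ne_zero h, ← mul_assoc, mul_div_cancel₀ _ h]

theorem shearCoeff_zero_left (s : ℝ) : shearCoeff 0 s = s := by simp [shearCoeff]

theorem shearCoeff_zero_right (t : ℝ) : shearCoeff t 0 = 0 := by simp [shearCoeff]

theorem shearCoeff_add (t s s' : ℝ) : shearCoeff t (s + s') =
    shearCoeff t s * Real.cos (t * s') + Real.cos (t * s) * shearCoeff t s' := by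
  rcases eq_or_ne t 0 with rfl | ht
  · simp [shearCoeff_zero_left]
  · apply mul_left_cancel₀ ht
    rw [mul_shearCoeff, mul_add t, Real.sin_add, ← mul_shearCoeff, ← mul_shearCoeff]
    ring

/-- The time `s` map of the linear flow `x' = -y`, `y' = t² x` of the plane. -/
noncomputable def shear (t s : ℝ) (z : ℂ) : ℂ :=
  ⟨z.re * Real.cos (t * s) - z.im * shearCoeff t s,
    z.im * Real.cos (t * s) + t * z.re * Real.sin (t * s)⟩

theorem shear_zero_right (t : ℝ) (z : ℂ) : shear t 0 z = z := by
  apply Complex.ext <;> simp [shear, shearCoeff_zero_right]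

theorem shear_add (t s s' : ℝ) (z : ℂ) : shear t (s + s') z = shear t s (shear t s' z) := by
  apply Complex.ext <;>
  · simp only [shear, shearCoeff_add, mul_add t, Real.cos_add, Real.sin_add, ← mul_shearCoeff]
    ring

theorem shear_smul (t s k : ℝ) (z : ℂ) : shear t s (k * z) = k * shear t s z := by
  apply Complex.ext <;> simp [shear] <;> ring

theorem shear_neg (t s : ℝ) (z : ℂ) : shear t s (-z) = -shear t s z := by
  simpa using shear_smul t s (-1) z

theorem shear_ne_zero {t s : ℝ} {z : ℂ} (hz : z ≠ 0) : shear t s z ≠ 0 := by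
  intro h
  have h2 : shear t (-s) (shear t s z) = z := by
    rw [← shear_add, neg_add_cancel, shear_zero_right]
  rw [h] at h2
  apply hz
  rw [← h2]
  apply Complex.ext <;> simp [shear]

theorem continuous_shear : Continuous fun p : ℝ × ℝ × ℂ => shear p.1 p.2.1 p.2.2 := by
  have h : Continuous fun p : ℝ × ℝ × ℂ => shearCoeff p.1 p.2.1 := by
    unfold shearCoeff
    exact (by fun_prop : Continuous fun p : ℝ × ℝ × ℂ => p.2.1).mul
      (Real.continuous_sinc.comp (by fun_prop))
  have hre : Continuous fun p : ℝ × ℝ × ℂ => p.2.2.re := Complex.continuous_re.comp (by fun_prop)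
  have him : Continuous fun p : ℝ × ℝ × ℂ => p.2.2.im := Complex.continuous_im.comp (by fun_prop)
  exact Complex.equivRealProdCLM.symm.continuous.comp
    (((hre.mul (by fun_prop)).sub (him.mul h)).prodMk
      ((him.mul (by fun_prop)).add ((continuous_fst.mul hre).mul (by fun_prop))))

/-- The flow induced by `shear t` on the circle of directions. -/
noncomputable def rot (t s : ℝ) (u : Circle) : Circle := direction (shear t s u)

theorem rot_zero_right (t : ℝ) (u : Circle) : rot t 0 u = u := by
  rw [rot, shear_zero_right, direction_coe]

/-- `direction` discards a positive factor, and the linear map `shear t s` carries that factor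
through unchanged. -/
theorem rot_add (t s s' : ℝ) (u : Circle) : rot t (s + s') u = rot t s (rot t s' u) := by
  have h := shear_ne_zero (t := t) (s := s') u.coe_ne_zero
  rw [rot, shear_add]
  conv_lhs => rw [← norm_mul_direction (shear t s' u), shear_smul]
  exact direction_smul (shear_ne_zero (Circle.coe_ne_zero _)) (norm_pos_iff.2 h)

theorem rot_neg (t s : ℝ) (u : Circle) : rot t s (-u) = -rot t s u := by
  rw [rot, Circle.coe_neg, shear_neg, direction_neg (shear_ne_zero u.coe_ne_zero), rot]

theorem continuous_rot : Continuous fun p : ℝ × ℝ × Circle => rot p.1 p.2.1 p.2.2 := by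
  have hi : Continuous ((↑) : Circle → ℂ) := continuous_induced_dom
  refine continuous_iff_continuousAt.2 fun p => ?_
  have h1 : Continuous fun p : ℝ × ℝ × Circle => shear p.1 p.2.1 p.2.2 :=
    continuous_shear.comp (by fun_prop : Continuous fun p : ℝ × ℝ × Circle => (p.1, p.2.1, (p.2.2 : ℂ)))
  exact (continuousAt_direction (shear_ne_zero p.2.2.coe_ne_zero)).comp
    (f := fun p : ℝ × ℝ × Circle => shear p.1 p.2.1 p.2.2) h1.continuousAt

theorem rot_zero_one (s : ℝ) : rot 0 s 1 = 1 :=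
  direction_eq_of_eq_smul one_pos (by apply Complex.ext <;> simp [shear])

theorem rot_zero_neg_one (s : ℝ) : rot 0 s (-1) = -1 := by rw [rot_neg, rot_zero_one]

theorem shear_zero_left (s : ℝ) (z : ℂ) : shear 0 s z = ⟨z.re - z.im * s, z.im⟩ := by
  simp [shear, shearCoeff_zero_left]

/-- At `t = 0` the linear map is a horizontal shear, which preserves the imaginary part;
normalization only rescales it positively. -/
theorem im_rot_zero_pos {u : Circle} (hu : 0 < (u : ℂ).im) (s : ℝ) : 0 < (rot 0 s u : ℂ).im := by
  have h := shear_ne_zero (t := 0) (s := s) u.coe_ne_zero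
  have : (‖shear 0 s u‖ : ℝ) * (rot 0 s u : ℂ).im = (u : ℂ).im := by
    have := congrArg Complex.im (norm_mul_direction (shear 0 s u))
    rw [Complex.im_ofReal_mul] at this
    rw [rot, this, shear_zero_left]
  exact pos_of_mul_pos_right (this ▸ hu) (norm_nonneg _)

theorem exists_rot_zero_eq {u w : Circle} (hu : 0 < (u : ℂ).im) (hw : 0 < (w : ℂ).im) :
    ∃ s, rot 0 s u = w := by
  -- The sheared vector keeps its imaginary part, so it must be `(im u / im w) w`; comparing real
  -- parts gives the time.
  refine ⟨((u : ℂ).re - (u : ℂ).im / (w : ℂ).im * (w : ℂ).re) / (u : ℂ).im,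
    direction_eq_of_eq_smul (div_pos hu hw) ?_⟩
  rw [shear_zero_left]
  apply Complex.ext
  · simp only [Complex.re_ofReal_mul]
    field_simp
    ring
  · simp only [Complex.im_ofReal_mul]
    field_simp

/-- Dividing the sheared vector by `s > 0` does not change its direction, and the quotient tends to
the negative real number `-im u`. -/
theorem tendsto_rot_zero_atTop {u : Circle} (hu : 0 < (u : ℂ).im) :
    Tendsto (fun s => rot 0 s u) atTop (𝓝 (-1)) := by
  have h0 : direction (-((u : ℂ).im : ℂ)) = -1 := direction_eq_of_eq_smul hu (by simp)
  rw [← h0]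
  have h1 : Tendsto (fun s : ℝ => ((s⁻¹ : ℝ) : ℂ) * u - ((u : ℂ).im : ℂ)) atTop
      (𝓝 (-((u : ℂ).im : ℂ))) := by
    have := ((Complex.continuous_ofReal.tendsto 0).comp tendsto_inv_atTop_zero).mul_const (u : ℂ)
      |>.sub_const ((u : ℂ).im : ℂ)
    simpa using this
  refine ((continuousAt_direction (by simpa using hu.ne')).tendsto.comp h1).congr' ?_
  filter_upwards [eventually_gt_atTop 0] with s hs
  rw [rot, ← direction_smul (shear_ne_zero u.coe_ne_zero) (inv_pos.2 hs), shear_zero_left]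
  refine congrArg direction (Complex.ext ?_ ?_)
  · simp only [Complex.sub_re, Complex.re_ofReal_mul, Complex.ofReal_re]
    field_simp
  · simp [-Complex.ofReal_inv]

theorem tendsto_rot_zero_atBot {u : Circle} (hu : 0 < (u : ℂ).im) :
    Tendsto (fun s => rot 0 s u) atBot (𝓝 1) := by
  have h0 : direction ((u : ℂ).im : ℂ) = 1 := direction_eq_of_eq_smul hu (by simp)
  rw [← h0]
  have h1 : Tendsto (fun s : ℝ => ((-s⁻¹ : ℝ) : ℂ) * u + ((u : ℂ).im : ℂ)) atBot
      (𝓝 ((u : ℂ).im : ℂ)) := by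
    have := ((Complex.continuous_ofReal.tendsto _).comp
      (tendsto_inv_atBot_zero.neg)).mul_const (u : ℂ) |>.add_const ((u : ℂ).im : ℂ)
    simpa using this
  refine ((continuousAt_direction (by simpa using hu.ne')).tendsto.comp h1).congr' ?_
  filter_upwards [eventually_lt_atBot 0] with s hs
  rw [rot, ← direction_smul (shear_ne_zero u.coe_ne_zero) (neg_pos.2 (inv_lt_zero.2 hs)),
    shear_zero_left]
  refine congrArg direction (Complex.ext ?_ ?_)
  · simp only [Complex.add_re, Complex.re_ofReal_mul, Complex.ofReal_re]
    field_simp [hs.ne]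
    ring
  · simp [-Complex.ofReal_inv, -Complex.ofReal_neg]

theorem rot_period {t : ℝ} (ht : 0 < t) (u : Circle) : rot t (2 * Real.pi / t) u = u := by
  have h : t * (2 * Real.pi / t) = 2 * Real.pi := by field_simp
  have h2 : shearCoeff t (2 * Real.pi / t) = 0 := by
    have := mul_shearCoeff t (2 * Real.pi / t)
    rw [h, Real.sin_two_pi] at this
    exact (mul_eq_zero.1 this).resolve_left ht.ne'
  rw [rot, shear, h, h2]
  simp [direction_coe]

/-- A fixed direction is an eigenvector of `shear t s` with a positive eigenvalue `k`. This forces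
`sin (t s) = 0` and `cos (t s) > 0`; the sign rules out the half turn. -/
theorem rot_ne_self {t s : ℝ} (ht : 0 < t) (hs : s ∈ Ioo 0 (2 * Real.pi / t)) (u : Circle) :
    rot t s u ≠ u := by
  intro h
  have hn : shear t s u ≠ 0 := shear_ne_zero u.coe_ne_zero
  have hk : 0 < ‖shear t s u‖ := norm_pos_iff.2 hn
  have hz := norm_mul_direction (shear t s u)
  rw [show direction (shear t s u) = u from h] at hz
  set k := ‖shear t s u‖
  have hre := congrArg Complex.re hz
  have him := congrArg Complex.im hz
  simp only [Complex.re_ofReal_mul, Complex.im_ofReal_mul, shear, ← mul_shearCoeff] at hre him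
  have hu0 : 0 < (u : ℂ).im ^ 2 + (t * (u : ℂ).re) ^ 2 := by
    rcases eq_or_ne (u : ℂ).im 0 with h0 | h0
    · have : (u : ℂ).re ≠ 0 := fun h1 => u.coe_ne_zero (Complex.ext h1 h0)
      positivity
    · positivity
  have hS : shearCoeff t s = 0 := by
    -- The determinant of `u` and its image eliminates both `k` and the cosine, leaving a definite
    -- quadratic form.
    refine (mul_eq_zero.1 (?_ : shearCoeff t s * ((u : ℂ).im ^ 2 + (t * (u : ℂ).re) ^ 2) = 0)).resolve_right hu0.ne'
    linear_combination (u : ℂ).im * hre - (u : ℂ).re * him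
  have hsin : Real.sin (t * s) = 0 := by rw [← mul_shearCoeff, hS, mul_zero]
  have hcos : 0 < Real.cos (t * s) := by
    rw [hS] at hre him
    have : (Real.cos (t * s) - k) * (u : ℂ) = 0 := by
      apply Complex.ext
      · simp only [← Complex.ofReal_sub, Complex.re_ofReal_mul, Complex.zero_re]
        linear_combination -hre
      · simp only [← Complex.ofReal_sub, Complex.im_ofReal_mul, Complex.zero_im]
        linear_combination -him
    have := (mul_eq_zero.1 this).resolve_right u.coe_ne_zero
    have : Real.cos (t * s) - k = 0 := by exact_mod_cast this
    linarith
  have h1 : 0 < t * s := mul_pos ht hs.1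
  have h2 : t * s < 2 * Real.pi := by
    have := hs.2
    rwa [lt_div_iff₀ ht, mul_comm] at this
  have h3 : Real.cos (t * s) = 1 := by
    have := Real.sin_sq_add_cos_sq (t * s)
    rw [hsin] at this
    nlinarith
  rw [Real.cos_eq_one_iff_of_lt_of_lt (by linarith) h2] at h3
  linarith

end CircleFlow

/-! ### Gluing the annuli along their boundary circles -/

section Surface

variable {n : ℕ}

/-- The boundary circles of `n` annuli. -/
abbrev Dart (n : ℕ) : Type := Fin n × Bool

/-- The disjoint union of `n` closed annuli. -/
abbrev Annuli (n : ℕ) : Type := Fin n × Circle × unitInterval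

/-- The height above the boundary circle `δ`. -/
def height (δ : Dart n) (r : unitInterval) : unitInterval :=
  if δ.2 then unitInterval.symm r else r

theorem height_height (δ : Dart n) (r : unitInterval) : height δ (height δ r) = r := by
  unfold height
  split_ifs <;> simp

theorem continuous_height (δ : Dart n) : Continuous (height δ) := by
  unfold height
  split_ifs <;> fun_prop

/-- The point at height `r` above the point `u` of the boundary circle `δ`. -/
def annulusPoint (δ : Dart n) (u : Circle) (r : unitInterval) : Annuli n := (δ.1, u, height δ r)

theorem continuous_annulusPoint (δ : Dart n) :
    Continuous fun x : Circle × unitInterval => annulusPoint δ x.1 x.2 :=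
  continuous_const.prodMk (continuous_fst.prodMk ((continuous_height δ).comp continuous_snd))

theorem annulusPoint_height {δ : Dart n} {q : Annuli n} (h : q.1 = δ.1) :
    annulusPoint δ q.2.1 (height δ q.2.2) = q := by
  rw [annulusPoint, height_height, ← h]

theorem eventually_exists_annulusPoint {δ : Dart n} {u : Circle} {r : unitInterval}
    {P : Circle × unitInterval → Prop} (h : ∀ᶠ x in 𝓝 (u, r), P x) :
    ∀ᶠ q in 𝓝 (annulusPoint δ u r), ∃ x, P x ∧ annulusPoint δ x.1 x.2 = q := by
  have h1 : ∀ᶠ q : Annuli n in 𝓝 (annulusPoint δ u r), q.1 = δ.1 :=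
    ((isOpen_discrete {δ.1}).preimage continuous_fst).mem_nhds rfl
  have h2 : ContinuousAt (fun q : Annuli n => (q.2.1, height δ q.2.2)) (annulusPoint δ u r) :=
    ((continuous_fst.comp continuous_snd).prodMk
      ((continuous_height δ).comp (continuous_snd.comp continuous_snd))).continuousAt
  have h3 : ((annulusPoint δ u r).2.1, height δ (annulusPoint δ u r).2.2) = (u, r) := by
    simp [annulusPoint, height_height]
  rw [ContinuousAt, h3] at h2
  filter_upwards [h1, h2.eventually h] with q hq1 hq2
  exact ⟨_, hq2, annulusPoint_height hq1⟩

theorem eq_one_or_neg_one_of_im_eq_zero {u : Circle} (h : (u : ℂ).im = 0) : u = 1 ∨ u = -1 := by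
  have h1 := u.normSq_coe
  rw [Complex.normSq_apply, h, mul_zero, add_zero] at h1
  rcases mul_self_eq_one_iff.1 h1 with h2 | h2
  · exact Or.inl (Circle.ext (Complex.ext (by simp [h2]) (by simp [h])))
  · exact Or.inr (Circle.ext (Complex.ext (by simp [h2]) (by simp [h])))

/-- The corners of the glued boundary circles. -/
abbrev Corner (σ : Equiv.Perm (Dart n)) : Type := Quotient (Equiv.Perm.SameCycle.setoid (σ * σ))

/-- The points of the surface: interior points of the annuli, points of the open arcs, corners. -/
inductive Label (σ : Equiv.Perm (Dart n)) : Type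
  | inner (p : Annuli n) : Label σ
  | arc (δ : Dart n) (u : Circle) : Label σ
  | corner (c : Corner σ) : Label σ

variable (σ : Equiv.Perm (Dart n))

/-- The corner from which the upper arc of the boundary circle `δ` starts. -/
def cornerOf (δ : Dart n) : Corner σ := Quotient.mk _ δ

theorem cornerOf_eq_iff {δ δ' : Dart n} :
    cornerOf σ δ = cornerOf σ δ' ↔ (σ * σ).SameCycle δ δ' :=
  ⟨fun h => Quotient.exact h, fun h => Quotient.sound h⟩

theorem cornerOf_apply_apply (δ : Dart n) : cornerOf σ (σ (σ δ)) = cornerOf σ δ :=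
  (cornerOf_eq_iff σ).2 (Equiv.Perm.SameCycle.symm ⟨1, by simp⟩)

open Classical in
/-- The label of a boundary point: the upper arc of the circle `δ` is glued to the lower arc of the
circle `σ δ` by the antipodal map. -/
noncomputable def boundaryLabel (δ : Dart n) (u : Circle) : Label σ :=
  if 0 < (u : ℂ).im then .arc δ u
  else if (u : ℂ).im < 0 then .arc (σ.symm δ) (-u)
  else if u = 1 then .corner (cornerOf σ δ) else .corner (cornerOf σ (σ δ))

theorem boundaryLabel_of_pos (δ : Dart n) {u : Circle} (h : 0 < (u : ℂ).im) :
    boundaryLabel σ δ u = .arc δ u := if_pos h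

theorem boundaryLabel_of_neg (δ : Dart n) {u : Circle} (h : (u : ℂ).im < 0) :
    boundaryLabel σ δ u = .arc (σ.symm δ) (-u) := by
  rw [boundaryLabel, if_neg h.not_gt, if_pos h]

theorem boundaryLabel_one (δ : Dart n) : boundaryLabel σ δ 1 = .corner (cornerOf σ δ) := by
  simp [boundaryLabel]

theorem boundaryLabel_neg_one (δ : Dart n) :
    boundaryLabel σ δ (-1) = .corner (cornerOf σ (σ δ)) := by
  simp [boundaryLabel, Circle.neg_ne_self]

/-- The gluing extends to the ends of the arcs. At `u = 1` this identifies the corners of `δ` and `σ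
(σ δ)`, which is why corners are cycles of `σ * σ`. -/
theorem boundaryLabel_apply_neg (δ : Dart n) {u : Circle} (h : 0 ≤ (u : ℂ).im) :
    boundaryLabel σ (σ δ) (-u) = boundaryLabel σ δ u := by
  rcases h.eq_or_lt with h | h
  · rcases eq_one_or_neg_one_of_im_eq_zero h.symm with rfl | rfl
    · rw [boundaryLabel_one, boundaryLabel_neg_one, cornerOf_apply_apply]
    · rw [neg_neg, boundaryLabel_one, boundaryLabel_neg_one]
  · rw [boundaryLabel_of_neg σ _ (by simpa using h), boundaryLabel_of_pos σ _ h, neg_neg,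
      Equiv.symm_apply_apply]

theorem boundaryLabel_ne_inner (δ : Dart n) (u : Circle) (p : Annuli n) :
    boundaryLabel σ δ u ≠ .inner p := by
  unfold boundaryLabel
  split_ifs <;> exact fun h => by cases h

theorem exists_boundaryLabel_eq_corner (δ : Dart n) {u : Circle} (h : (u : ℂ).im = 0) :
    ∃ c, boundaryLabel σ δ u = .corner c := by
  rcases eq_one_or_neg_one_of_im_eq_zero h with rfl | rfl
  · exact ⟨_, boundaryLabel_one σ δ⟩
  · exact ⟨_, boundaryLabel_neg_one σ δ⟩

theorem exists_boundaryLabel_eq_arc (δ : Dart n) {u : Circle} (h : (u : ℂ).im ≠ 0) :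
    ∃ δ' u', boundaryLabel σ δ u = .arc δ' u' := by
  rcases h.lt_or_gt with h | h
  · exact ⟨_, _, boundaryLabel_of_neg σ δ h⟩
  · exact ⟨_, _, boundaryLabel_of_pos σ δ h⟩

theorem im_eq_zero_iff_of_boundaryLabel_eq {δ δ' : Dart n} {u u' : Circle}
    (h : boundaryLabel σ δ u = boundaryLabel σ δ' u') : (u : ℂ).im = 0 ↔ (u' : ℂ).im = 0 := by
  constructor <;> intro h0 <;> by_contra h1
  · obtain ⟨c, hc⟩ := exists_boundaryLabel_eq_corner σ δ h0
    obtain ⟨_, _, ha⟩ := exists_boundaryLabel_eq_arc σ δ' h1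
    rw [hc, ha] at h
    cases h
  · obtain ⟨c, hc⟩ := exists_boundaryLabel_eq_corner σ δ' h0
    obtain ⟨_, _, ha⟩ := exists_boundaryLabel_eq_arc σ δ h1
    rw [hc, ha] at h
    cases h

/-- The last alternative does not record which corners coincide; this is harmless because there are
only finitely many corner points. -/
theorem eq_or_of_boundaryLabel_eq {δ δ' : Dart n} {u u' : Circle}
    (h : boundaryLabel σ δ u = boundaryLabel σ δ' u') :
    (δ = δ' ∧ u = u') ∨ (0 ≤ (u : ℂ).im ∧ δ' = σ δ ∧ u' = -u) ∨
      (0 ≤ (u' : ℂ).im ∧ δ = σ δ' ∧ u = -u') ∨ ((u : ℂ).im = 0 ∧ (u' : ℂ).im = 0) := by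
  have h0 := im_eq_zero_iff_of_boundaryLabel_eq σ h
  rcases lt_trichotomy (u : ℂ).im 0 with hu | hu | hu
  · rcases lt_trichotomy (u' : ℂ).im 0 with hu' | hu' | hu'
    · rw [boundaryLabel_of_neg σ _ hu, boundaryLabel_of_neg σ _ hu'] at h
      injection h with ha hb
      exact Or.inl ⟨σ.symm.injective ha, neg_injective hb⟩
    · exact absurd (h0.2 hu') hu.ne
    · rw [boundaryLabel_of_neg σ _ hu, boundaryLabel_of_pos σ _ hu'] at h
      injection h with ha hb
      exact Or.inr (Or.inr (Or.inl ⟨hu'.le, by rw [← ha, Equiv.apply_symm_apply],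
        by rw [← hb, neg_neg]⟩))
  · exact Or.inr (Or.inr (Or.inr ⟨hu, h0.1 hu⟩))
  · rcases lt_trichotomy (u' : ℂ).im 0 with hu' | hu' | hu'
    · rw [boundaryLabel_of_pos σ _ hu, boundaryLabel_of_neg σ _ hu'] at h
      injection h with ha hb
      exact Or.inr (Or.inl ⟨hu.le, by rw [ha, Equiv.apply_symm_apply], by rw [hb, neg_neg]⟩)
    · exact absurd (h0.2 hu') hu.ne'
    · rw [boundaryLabel_of_pos σ _ hu, boundaryLabel_of_pos σ _ hu'] at h
      injection h with ha hb
      exact Or.inl ⟨ha, hb⟩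

/-- The label of a point of the annuli; points with the same label are identified. -/
noncomputable def label (p : Annuli n) : Label σ :=
  if p.2.2 = 0 then boundaryLabel σ (p.1, false) p.2.1
  else if p.2.2 = 1 then boundaryLabel σ (p.1, true) p.2.1 else .inner p

theorem label_annulusPoint_zero (δ : Dart n) (u : Circle) :
    label σ (annulusPoint δ u 0) = boundaryLabel σ δ u := by
  obtain ⟨e, b⟩ := δ
  cases b <;> simp [label, annulusPoint, height]

theorem label_of_mem_Ioo {p : Annuli n} (h : (p.2.2 : ℝ) ∈ Ioo (0 : ℝ) 1) : label σ p = .inner p := by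
  rw [label, if_neg, if_neg]
  · intro h'
    rw [h'] at h
    exact lt_irrefl _ h.2
  · intro h'
    rw [h'] at h
    exact lt_irrefl _ h.1

theorem exists_annulusPoint_zero_or (p : Annuli n) :
    (∃ δ u, p = annulusPoint δ u 0) ∨ (p.2.2 : ℝ) ∈ Ioo (0 : ℝ) 1 := by
  obtain ⟨e, u, r⟩ := p
  rcases eq_or_ne r 0 with rfl | h0
  · exact Or.inl ⟨(e, false), u, rfl⟩
  rcases eq_or_ne r 1 with rfl | h1
  · exact Or.inl ⟨(e, true), u, by simp [annulusPoint, height]⟩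
  · exact Or.inr ⟨unitInterval.pos_iff_ne_zero.2 h0, unitInterval.lt_one_iff_ne_one.2 h1⟩

theorem height_mem_Ioo {δ : Dart n} {r : unitInterval} (h : (r : ℝ) ∈ Ioo (0 : ℝ) 1) :
    (height δ r : ℝ) ∈ Ioo (0 : ℝ) 1 := by
  unfold height
  split_ifs
  · rw [unitInterval.coe_symm_eq]
    exact ⟨by linarith [h.2], by linarith [h.1]⟩
  · exact h

/-- The surface obtained from the annuli by gluing their boundary circles. -/
def Surface : Type := Quotient (Setoid.ker (label σ))

instance : TopologicalSpace (Surface σ) := inferInstanceAs (TopologicalSpace (Quotient _))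

/-- The projection of the annuli onto the surface. -/
noncomputable def proj (p : Annuli n) : Surface σ := Quotient.mk _ p

theorem isQuotientMap_proj : IsQuotientMap (proj σ) := isQuotientMap_quotient_mk'

theorem continuous_proj : Continuous (proj σ) := (isQuotientMap_proj σ).continuous

theorem proj_surjective : Function.Surjective (proj σ) := (isQuotientMap_proj σ).surjective

theorem proj_eq_iff {p q : Annuli n} : proj σ p = proj σ q ↔ label σ p = label σ q :=
  ⟨fun h => Quotient.exact h, fun h => Quotient.sound h⟩

/-- The relation is a finite union of closed pieces: the diagonal, the compact graphs of the arc
gluings and their transposes, and finitely many pairs of corner points. -/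
theorem isClosed_ker_proj : IsClosed {p : Annuli n × Annuli n | proj σ p.1 = proj σ p.2} := by
  set P : Dart n → Set (Annuli n × Annuli n) := fun δ =>
    (fun u => (annulusPoint δ u 0, annulusPoint (σ δ) (-u) 0)) '' {u : Circle | 0 ≤ (u : ℂ).im}
    with hP
  set T : Set (Annuli n) := range fun δ => annulusPoint δ 1 0 with hT
  set T' : Set (Annuli n) := range fun δ => annulusPoint δ (-1) 0 with hT'
  have him : Continuous fun u : Circle => (u : ℂ).im :=
    Complex.continuous_im.comp continuous_induced_dom
  have hc : ∀ δ : Dart n, Continuous fun u => annulusPoint δ u 0 := fun δ =>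
    (continuous_annulusPoint δ).comp (continuous_id.prodMk continuous_const)
  have hPc : ∀ δ, IsClosed (P δ) := fun δ =>
    ((isClosed_le continuous_const him).isCompact.image
      ((hc δ).prodMk ((hc _).comp continuous_neg))).isClosed
  have hfin : ((T ∪ T') ×ˢ (T ∪ T')).Finite :=
    ((finite_range _).union (finite_range _)).prod ((finite_range _).union (finite_range _))
  have hmem : ∀ (δ : Dart n) (u : Circle), (u : ℂ).im = 0 → annulusPoint δ u 0 ∈ T ∪ T' := by
    intro δ u hu
    rcases eq_one_or_neg_one_of_im_eq_zero hu with rfl | rfl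
    · exact Or.inl ⟨δ, rfl⟩
    · exact Or.inr ⟨δ, rfl⟩
  have heq : {p : Annuli n × Annuli n | proj σ p.1 = proj σ p.2} =
      (diagonal _ ∪ (⋃ δ, P δ)) ∪ ((⋃ δ, Prod.swap ⁻¹' P δ) ∪
        ((T ∪ T') ×ˢ (T ∪ T')) ∩ {p | proj σ p.1 = proj σ p.2}) := by
    ext ⟨p, q⟩
    simp only [mem_union, mem_ofPred_eq, mem_iUnion, mem_inter_iff, mem_diagonal_iff, proj_eq_iff]
    constructor
    · intro h
      rcases exists_annulusPoint_zero_or p with ⟨δ, u, rfl⟩ | hp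
      · rcases exists_annulusPoint_zero_or q with ⟨δ', u', rfl⟩ | hq
        · have h' := h
          rw [label_annulusPoint_zero, label_annulusPoint_zero] at h'
          rcases eq_or_of_boundaryLabel_eq σ h' with ⟨rfl, rfl⟩ | ⟨h0, rfl, rfl⟩ | ⟨h0, rfl, rfl⟩ | ⟨h0, h1⟩
          · exact Or.inl (Or.inl rfl)
          · exact Or.inl (Or.inr ⟨δ, u, h0, rfl⟩)
          · exact Or.inr (Or.inl ⟨δ', u', h0, rfl⟩)
          · exact Or.inr (Or.inr ⟨⟨hmem _ _ h0, hmem _ _ h1⟩, h⟩)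
        · rw [label_annulusPoint_zero, label_of_mem_Ioo σ hq] at h
          exact absurd h (boundaryLabel_ne_inner σ _ _ _)
      · rcases exists_annulusPoint_zero_or q with ⟨δ', u', rfl⟩ | hq
        · rw [label_annulusPoint_zero, label_of_mem_Ioo σ hp] at h
          exact absurd h.symm (boundaryLabel_ne_inner σ _ _ _)
        · rw [label_of_mem_Ioo σ hp, label_of_mem_Ioo σ hq] at h
          injection h with h
          exact Or.inl (Or.inl h)
    · rintro ((h | ⟨δ, u, h0, h⟩) | ⟨δ, u, h0, h⟩ | ⟨-, h⟩)
      · rw [h]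
      · obtain ⟨rfl, rfl⟩ := Prod.mk.inj h
        rw [label_annulusPoint_zero, label_annulusPoint_zero, boundaryLabel_apply_neg σ _ h0]
      · obtain ⟨rfl, rfl⟩ := Prod.mk.inj h
        rw [label_annulusPoint_zero, label_annulusPoint_zero, boundaryLabel_apply_neg σ _ h0]
      · exact h
  rw [heq]
  exact (isClosed_diagonal.union (isClosed_iUnion_of_finite hPc)).union
    ((isClosed_iUnion_of_finite fun δ => (hPc δ).preimage continuous_swap).union
      (hfin.subset inter_subset_left).isClosed)

instance : CompactSpace (Surface σ) := inferInstanceAs (CompactSpace (Quotient _))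

instance : T2Space (Surface σ) := t2Space_of_isClosed_ker (isQuotientMap_proj σ) (isClosed_ker_proj σ)

theorem isClosedMap_proj : IsClosedMap (proj σ) :=
  isClosedMap_of_isClosed_ker (isQuotientMap_proj σ) (isClosed_ker_proj σ)

end Surface

/-! ### Roots of unity along a cycle, and coordinates on the circle -/

section Roots

/-- The principal arguments are `∓π / 2`. The factor is the angle by which neighboring sectors at a
corner must be turned so that their edges match. -/
theorem mul_I_cpow_inv {m : ℕ} {x : ℝ} (hx : 0 < x) :
    (-(x * Complex.I)) ^ (m : ℂ)⁻¹ =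
      Complex.exp (-(Real.pi * Complex.I / m)) * (x * Complex.I) ^ (m : ℂ)⁻¹ := by
  have h1 : (x * Complex.I : ℂ) ≠ 0 := mul_ne_zero (by exact_mod_cast hx.ne') Complex.I_ne_zero
  have h2 : Complex.log (x * Complex.I) = Real.log x + Real.pi / 2 * Complex.I := by
    rw [Complex.log_ofReal_mul hx Complex.I_ne_zero, Complex.log_I]
  have h3 : Complex.log (-(x * Complex.I)) = Real.log x - Real.pi / 2 * Complex.I := by
    rw [← mul_neg, Complex.log_ofReal_mul hx (neg_ne_zero.2 Complex.I_ne_zero), Complex.log_neg_I]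
    ring
  rw [Complex.cpow_def_of_ne_zero h1, Complex.cpow_def_of_ne_zero (neg_ne_zero.2 h1), h2, h3,
    ← Complex.exp_add]
  congr 1
  ring

/-- A cycle of a permutation is parametrized by roots of unity. -/
theorem exists_cycle_coordinate {α : Type*} [Finite α] (τ : Equiv.Perm α) (a₀ : α) :
    ∃ m : ℕ, m ≠ 0 ∧ ∃ κ : α → ℂ, (∀ a, τ.SameCycle a₀ a → κ a ^ m = 1) ∧
      (∀ a b, τ.SameCycle a₀ a → τ.SameCycle a₀ b → κ a = κ b → a = b) ∧
      (∀ a, τ.SameCycle a₀ a →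
        κ (τ a) = κ a * Complex.exp (-(Real.pi * Complex.I / m)) ^ 2) ∧
      (∀ w : ℂ, w ^ m = 1 → ∃ a, τ.SameCycle a₀ a ∧ κ a = w) := by
  set m := Function.minimalPeriod (τ • ·) a₀ with hm
  have hm0 : m ≠ 0 := (MulAction.minimalPeriod_pos τ a₀).ne
  set ξ : ℂ := Complex.exp (-(Real.pi * Complex.I / m)) ^ 2 with hξ
  have hprim : IsPrimitiveRoot ξ m := by
    have h := (Complex.isPrimitiveRoot_exp m hm0).inv
    have he : ξ = (Complex.exp (2 * Real.pi * Complex.I / m))⁻¹ := by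
      rw [hξ, ← Complex.exp_nat_mul, ← Complex.exp_neg]
      congr 1
      push_cast
      ring
    rw [he]
    exact h
  have hξ0 : ξ ≠ 0 := hprim.ne_zero hm0
  have hper : ∀ j : ℤ, ξ ^ j = 1 ↔ (τ ^ j) a₀ = a₀ := fun j => by
    rw [hprim.zpow_eq_one_iff_dvd, hm, ← MulAction.zpow_smul_eq_iff_minimalPeriod_dvd]
    rfl
  -- Both sides see exponents modulo the length `m` of the cycle, so `ξ ^ j` is a well-defined and
  -- injective coordinate of `(τ ^ j) a₀`.
  have heq : ∀ i j : ℤ, ξ ^ i = ξ ^ j ↔ (τ ^ i) a₀ = (τ ^ j) a₀ := fun i j => by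
    have h1 : ξ ^ i = ξ ^ j ↔ ξ ^ (-j + i) = 1 := by
      rw [zpow_add₀ hξ0, zpow_neg, inv_mul_eq_one₀ (zpow_ne_zero _ hξ0), eq_comm]
    rw [h1, hper, zpow_add, Equiv.Perm.mul_apply, zpow_neg, Equiv.Perm.inv_eq_iff_eq, eq_comm]
  have hex : ∀ a, ∃ j : ℤ, τ.SameCycle a₀ a → (τ ^ j) a₀ = a := fun a => by
    by_cases h : τ.SameCycle a₀ a
    · obtain ⟨j, hj⟩ := h
      exact ⟨j, fun _ => hj⟩
    · exact ⟨0, fun h' => absurd h' h⟩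
  choose j hj using hex
  refine ⟨m, hm0, fun a => ξ ^ j a, ?_, ?_, ?_, ?_⟩
  · intro a _
    rw [← zpow_natCast, zpow_comm, zpow_natCast, hprim.pow_eq_one, one_zpow]
  · intro a b ha hb h
    rw [← hj a ha, ← hj b hb, ← heq]
    exact h
  · intro a ha
    have : ξ ^ j (τ a) = ξ ^ (1 + j a) := by
      rw [heq, hj _ (Equiv.Perm.sameCycle_apply_right.2 ha), zpow_add, Equiv.Perm.mul_apply, hj a ha, zpow_one]
    change ξ ^ j (τ a) = ξ ^ j a * ξ
    rw [this, zpow_add₀ hξ0, zpow_one, mul_comm]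
  · intro w hw
    have : NeZero m := ⟨hm0⟩
    obtain ⟨i, -, rfl⟩ := hprim.eq_pow_of_pow_eq_one hw
    have hs : τ.SameCycle a₀ ((τ ^ (i : ℤ)) a₀) := ⟨i, rfl⟩
    refine ⟨_, hs, ?_⟩
    rw [← zpow_natCast, heq, hj _ hs]

theorem exists_circle_coe_eq {x y : ℝ} (h : x ^ 2 + y ^ 2 = 1) :
    ∃ u : Circle, (u : ℂ).re = x ∧ (u : ℂ).im = y := by
  refine ⟨⟨⟨x, y⟩, mem_sphere_zero_iff_norm.2 ?_⟩, rfl, rfl⟩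
  rw [← sq_eq_sq₀ (norm_nonneg _) zero_le_one, Complex.sq_norm, Complex.normSq_apply]
  linarith

theorem circle_re_sq_add_im_sq (u : Circle) : (u : ℂ).re ^ 2 + (u : ℂ).im ^ 2 = 1 := by
  have := u.normSq_coe
  rw [Complex.normSq_apply] at this
  linarith

theorem circle_ext_of_re_pos {u w : Circle} (hu : 0 < (u : ℂ).re) (hw : 0 < (w : ℂ).re)
    (h : (u : ℂ).im = (w : ℂ).im) : u = w := by
  refine Circle.ext (Complex.ext ?_ h)
  have h1 := circle_re_sq_add_im_sq u
  have h2 := circle_re_sq_add_im_sq w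
  rw [h] at h1
  exact (sq_eq_sq₀ hu.le hw.le).1 (by linarith)

theorem circle_ext_of_im_pos {u w : Circle} (hu : 0 < (u : ℂ).im) (hw : 0 < (w : ℂ).im)
    (h : (u : ℂ).re = (w : ℂ).re) : u = w := by
  refine Circle.ext (Complex.ext h ?_)
  have h1 := circle_re_sq_add_im_sq u
  have h2 := circle_re_sq_add_im_sq w
  rw [h] at h1
  exact (sq_eq_sq₀ hu.le hw.le).1 (by linarith)

end Roots

/-! ### Sector coordinates, and charts inside the annuli -/

section Charts

variable {n : ℕ}

/-- Half-discs in the annuli: a boundary circle, one of its two corners, and coordinates. -/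
abbrev Sector (n : ℕ) : Type := Dart n × Bool × Circle × unitInterval

variable (σ : Equiv.Perm (Dart n))

/-- The point of the annuli given by sector coordinates. -/
noncomputable def sectorPoint (z : Sector n) : Annuli n :=
  annulusPoint (if z.2.1 then σ z.1 else z.1) (if z.2.1 then -z.2.2.1 else z.2.2.1) z.2.2.2

theorem continuous_sectorPoint : Continuous (sectorPoint σ) := by
  refine continuous_prod_of_discrete_left.2 fun δ => continuous_prod_of_discrete_left.2 fun b => ?_
  cases b
  · exact continuous_annulusPoint δ
  · exact (continuous_annulusPoint (σ δ)).comp (continuous_fst.neg.prodMk continuous_snd)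

/-- The bound `1 / 4`, being below `1 / 2`, keeps the collars of the two boundary circles of one
annulus disjoint. -/
theorem annulusPoint_inj {δ δ' : Dart n} {u u' : Circle} {r r' : unitInterval}
    (hr : (r : ℝ) ≤ 1 / 4) (hr' : (r' : ℝ) ≤ 1 / 4) :
    annulusPoint δ u r = annulusPoint δ' u' r' ↔ δ = δ' ∧ u = u' ∧ r = r' := by
  refine ⟨fun h => ?_, by rintro ⟨rfl, rfl, rfl⟩; rfl⟩
  obtain ⟨e, b⟩ := δ
  obtain ⟨e', b'⟩ := δ'
  simp only [annulusPoint, Prod.mk.injEq] at h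
  obtain ⟨rfl, rfl, h⟩ := h
  have h' := congrArg (fun x : unitInterval => (x : ℝ)) h
  cases b <;> cases b' <;> simp [height] at h h' ⊢
  · exact h
  · linarith
  · linarith
  · exact h

theorem label_annulusPoint_of_pos {δ : Dart n} {u : Circle} {r : unitInterval}
    (hr : (r : ℝ) ≤ 1 / 4) (h0 : 0 < (r : ℝ)) :
    label σ (annulusPoint δ u r) = .inner (annulusPoint δ u r) :=
  label_of_mem_Ioo σ (height_mem_Ioo ⟨h0, by linarith⟩)

theorem proj_annulusPoint_eq_iff_of_pos {δ δ' : Dart n} {u u' : Circle} {r r' : unitInterval}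
    (hr : (r : ℝ) ≤ 1 / 4) (hr' : (r' : ℝ) ≤ 1 / 4) (h0 : 0 < (r : ℝ)) :
    proj σ (annulusPoint δ u r) = proj σ (annulusPoint δ' u' r') ↔ δ = δ' ∧ u = u' ∧ r = r' := by
  rw [← annulusPoint_inj hr hr', proj_eq_iff]
  refine ⟨fun h => ?_, fun h => by rw [h]⟩
  rw [label_annulusPoint_of_pos σ hr h0] at h
  rcases r'.2.1.eq_or_lt with h1 | h1
  · have : r' = 0 := Subtype.ext h1.symm
    rw [this, label_annulusPoint_zero] at h
    exact absurd h.symm (boundaryLabel_ne_inner σ _ _ _)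
  · rw [label_annulusPoint_of_pos σ hr' h1] at h
    injection h

theorem proj_annulusPoint_zero_eq_iff {δ δ' : Dart n} {u u' : Circle} {r' : unitInterval}
    (hr' : (r' : ℝ) ≤ 1 / 4) :
    proj σ (annulusPoint δ u 0) = proj σ (annulusPoint δ' u' r') ↔
      r' = 0 ∧ boundaryLabel σ δ u = boundaryLabel σ δ' u' := by
  rcases r'.2.1.eq_or_lt with h1 | h1
  · obtain rfl : r' = 0 := Subtype.ext h1.symm
    rw [proj_eq_iff, label_annulusPoint_zero, label_annulusPoint_zero]
    simp
  · rw [proj_eq_iff, label_annulusPoint_zero, label_annulusPoint_of_pos σ hr' h1]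
    refine ⟨fun h => absurd h (boundaryLabel_ne_inner σ _ _ _), fun h => ?_⟩
    rw [h.1] at h1
    exact absurd h1 (lt_irrefl _)

theorem exists_chart_inner {p : Annuli n} (hp : (p.2.2 : ℝ) ∈ Ioo (0 : ℝ) 1) :
    ∃ e : OpenPartialHomeomorph (Surface σ) ℂ, proj σ p ∈ e.source := by
  obtain ⟨a, ha0, ha⟩ := exists_between hp.1
  obtain ⟨b, hb, hb1⟩ := exists_between hp.2
  set K : Set (Annuli n) := {q | q.1 = p.1 ∧ (q.2.2 : ℝ) ∈ Icc a b} with hK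
  have hKc : IsClosed K := (isClosed_eq continuous_fst continuous_const).inter
    (isClosed_Icc.preimage (continuous_subtype_val.comp (continuous_snd.comp continuous_snd)))
  have : CompactSpace K := isCompact_iff_compactSpace.1 hKc.isCompact
  have hKn : K ∈ 𝓝 p := by
    refine inter_mem (((isOpen_discrete {p.1}).preimage continuous_fst).mem_nhds rfl) ?_
    exact (continuous_subtype_val.comp (continuous_snd.comp continuous_snd)).continuousAt
      (Icc_mem_nhds ha hb)
  -- Polar coordinates; the shift by `1` keeps the radius positive.
  set F : K → ℂ := fun q => ((1 + (q.1.2.2 : ℝ) : ℝ) : ℂ) * q.1.2.1 with hF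
  have hlab : ∀ q ∈ K, label σ q = .inner q := fun q hq =>
    label_of_mem_Ioo σ ⟨ha0.trans_le hq.2.1, hq.2.2.trans_lt hb1⟩
  have hnorm : ∀ q : K, ‖F q‖ = 1 + (q.1.2.2 : ℝ) := fun q => by
    rw [hF, norm_mul, Circle.norm_coe, mul_one, Complex.norm_real, Real.norm_of_nonneg]
    linarith [q.1.2.2.2.1]
  refine exists_openPartialHomeomorph_of_compact (g := fun q : K => proj σ q) (F := F)
    (z₀ := ⟨p, mem_of_mem_nhds hKn⟩) ((continuous_proj σ).comp continuous_subtype_val) ?_ ?_ ?_ ?_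
  · have h1 : Continuous fun q : K => (q.1.2.1 : ℂ) := continuous_induced_dom.comp (by fun_prop)
    have h2 : Continuous fun q : K => ((1 + (q.1.2.2 : ℝ) : ℝ) : ℂ) := by fun_prop
    exact h2.mul h1
  · intro q q'
    rw [proj_eq_iff, hlab _ q.2, hlab _ q'.2]
    constructor
    · intro h
      injection h with h
      rw [Subtype.ext h]
    · intro h
      have h1 : (q.1.2.2 : ℝ) = q'.1.2.2 := by
        have := hnorm q
        rw [h, hnorm] at this
        linarith
      have h2 : (q.1.2.1 : ℂ) = q'.1.2.1 := by
        have h3 : ((1 + (q.1.2.2 : ℝ) : ℝ) : ℂ) ≠ 0 := by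
          have := q.1.2.2.2.1
          exact_mod_cast (by linarith : 1 + (q.1.2.2 : ℝ) ≠ 0)
        simp only [hF, ← h1] at h
        exact mul_left_cancel₀ h3 h
      rw [Prod.ext (q.2.1.trans q'.2.1.symm) (Prod.ext (Circle.ext h2) (Subtype.ext h1))]
  · have : range (fun q : K => proj σ q) = proj σ '' K := by
      rw [image_eq_range]
    rw [this]
    refine image_mem_nhds_of_isClosedMap (isClosedMap_proj σ) (proj_surjective σ) fun q hq => ?_
    rw [proj_eq_iff, hlab _ (mem_of_mem_nhds hKn)] at hq
    rcases exists_annulusPoint_zero_or q with ⟨δ, u, rfl⟩ | h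
    · rw [label_annulusPoint_zero] at hq
      exact absurd hq (boundaryLabel_ne_inner σ _ _ _)
    · rw [label_of_mem_Ioo σ h] at hq
      injection hq with hq
      rwa [hq]
  · have ho : IsOpen {w : ℂ | ‖w‖ ∈ Ioo (1 + a) (1 + b)} := isOpen_Ioo.preimage continuous_norm
    refine mem_of_superset (ho.mem_nhds ?_) ?_
    · rw [mem_ofPred_eq, hnorm]
      exact ⟨by simpa using ha, by simpa using hb⟩
    · intro w hw
      refine ⟨⟨(p.1, direction w, ⟨‖w‖ - 1, by linarith [hw.1], by linarith [hw.2]⟩), rfl,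
        by simp only; linarith [hw.1], by simp only; linarith [hw.2]⟩, ?_⟩
      simp only [hF]
      rw [add_sub_cancel, norm_mul_direction]

end Charts

/-! ### Charts at the points of the open arcs -/

section SectorCharts

variable {n : ℕ} (σ : Equiv.Perm (Dart n))

theorem boundaryLabel_sector_of_nonneg (δ : Dart n) (b : Bool) {u : Circle} (h : 0 ≤ (u : ℂ).im) :
    boundaryLabel σ (if b then σ δ else δ) (if b then -u else u) = boundaryLabel σ δ u := by
  cases b
  · rfl
  · exact boundaryLabel_apply_neg σ δ h

theorem boundaryLabel_sector_of_neg (δ : Dart n) (b : Bool) {u : Circle} (h : (u : ℂ).im < 0) :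
    boundaryLabel σ (if b then σ δ else δ) (if b then -u else u) =
      .arc (if b then σ δ else σ.symm δ) (-u) := by
  cases b
  · exact boundaryLabel_of_neg σ δ h
  · exact boundaryLabel_of_pos σ (σ δ) (by simpa using h)

/-- Two collars, of `δ` and of `σ δ`, meet along the arc. The real part of `u` is a coordinate along
the arc, and the height taken with opposite signs on the two sides is the transverse one. -/
theorem exists_chart_arc (δ : Dart n) {u₀ : Circle} (hu₀ : 0 < (u₀ : ℂ).im) :
    ∃ e : OpenPartialHomeomorph (Surface σ) ℂ, proj σ (annulusPoint δ u₀ 0) ∈ e.source := by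
  have hcoe : Continuous fun u : Circle => (u : ℂ) := continuous_induced_dom
  have hre : Continuous fun u : Circle => (u : ℂ).re := Complex.continuous_re.comp hcoe
  have him : Continuous fun u : Circle => (u : ℂ).im := Complex.continuous_im.comp hcoe
  obtain ⟨ε, hε0, hε⟩ := exists_between hu₀
  set K : Set (Bool × Circle × unitInterval) := {z | ε ≤ (z.2.1 : ℂ).im ∧ (z.2.2 : ℝ) ≤ 1 / 4}
    with hK
  have hKc : IsClosed K :=
    (isClosed_le continuous_const (him.comp (continuous_fst.comp continuous_snd))).inter
      (isClosed_le (continuous_subtype_val.comp (continuous_snd.comp continuous_snd))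
        continuous_const)
  have : CompactSpace K := isCompact_iff_compactSpace.1 hKc.isCompact
  set F : Bool × Circle × unitInterval → ℂ := fun z =>
    ⟨(z.2.1 : ℂ).re, if z.1 then -(z.2.2 : ℝ) else z.2.2⟩ with hF
  have hFc : Continuous F := by
    refine continuous_prod_of_discrete_left.2 fun b => ?_
    refine Complex.equivRealProdCLM.symm.continuous.comp
      ((hre.comp continuous_fst).prodMk ?_)
    cases b
    · exact continuous_subtype_val.comp continuous_snd
    · exact (continuous_subtype_val.comp continuous_snd).neg
  set g : Bool × Circle × unitInterval → Surface σ := fun z => proj σ (sectorPoint σ (δ, z)) with hg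
  have hgc : Continuous g := (continuous_proj σ).comp
    ((continuous_sectorPoint σ).comp (by fun_prop))
  have hz₀ : ∀ b : Bool, (b, u₀, (0 : unitInterval)) ∈ K := fun b => ⟨hε.le, by norm_num⟩
  have hrel1 : ∀ z ∈ K, ∀ w ∈ K, F z = F w ↔ z.2 = w.2 ∧ (z.1 = w.1 ∨ z.2.2 = 0) := by
    rintro ⟨b, u, r⟩ ⟨hu, hr⟩ ⟨b', u', r'⟩ ⟨hu', hr'⟩
    simp only at hu hr hu' hr'
    have hr0 := r.2.1
    have hr0' := r'.2.1
    have hru : F (b, u, r) = F (b', u', r') ↔ u = u' ∧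
        (if b then -(r : ℝ) else r) = (if b' then -(r' : ℝ) else r') := by
      refine ⟨fun h => ⟨circle_ext_of_im_pos (hε0.trans_le hu) (hε0.trans_le hu')
        (congrArg Complex.re h :), congrArg Complex.im h⟩, fun h => Complex.ext ?_ h.2⟩
      rw [h.1]
    rw [hru, Prod.mk.injEq, and_assoc]
    refine and_congr_right fun _ => ?_
    have h0 : r = 0 ↔ (r : ℝ) = 0 := Subtype.ext_iff
    rw [h0, Subtype.ext_iff]
    have h1 : (r : ℝ) = -r' ↔ (r : ℝ) = r' ∧ (r : ℝ) = 0 :=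
      ⟨fun h => by constructor <;> linarith, fun h => by linarith [h.1, h.2]⟩
    have h2 : -(r : ℝ) = r' ↔ (r : ℝ) = r' ∧ (r : ℝ) = 0 :=
      ⟨fun h => by constructor <;> linarith, fun h => by linarith [h.1, h.2]⟩
    cases b <;> cases b' <;> simp only [reduceCtorEq, if_true, if_false, true_or, false_or, and_true, h1, h2, Bool.false_eq_true, neg_inj]
  have hrel2 : ∀ z ∈ K, ∀ w ∈ K, g z = g w ↔ z.2 = w.2 ∧ (z.1 = w.1 ∨ z.2.2 = 0) := by
    rintro ⟨b, u, r⟩ ⟨hu, hr⟩ ⟨b', u', r'⟩ ⟨hu', hr'⟩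
    simp only at hu hr hu' hr'
    have hu0 := hε0.trans_le hu
    have hu0' := hε0.trans_le hu'
    rcases r.2.1.eq_or_lt with h0 | h0
    · obtain rfl : r = 0 := Subtype.ext h0.symm
      refine (proj_annulusPoint_zero_eq_iff σ hr').trans ?_
      simp only
      rw [boundaryLabel_sector_of_nonneg σ _ _ hu0.le, boundaryLabel_sector_of_nonneg σ _ _ hu0'.le,
        boundaryLabel_of_pos σ _ hu0, boundaryLabel_of_pos σ _ hu0']
      simp [and_comm, eq_comm]
    · refine (proj_annulusPoint_eq_iff_of_pos σ hr hr' h0).trans ?_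
      have hne : r ≠ 0 := fun h => by rw [h] at h0; exact lt_irrefl _ h0
      have h1 : u ≠ -u' := by
        rintro rfl
        rw [Circle.coe_neg, Complex.neg_im] at hu0
        linarith
      have h2 : -u ≠ u' := fun h => h1 (by rw [← h, neg_neg])
      cases b <;> cases b' <;> simp [hne, h1, h2]
  refine exists_openPartialHomeomorph_of_compact (g := fun z : K => g z)
    (F := fun z : K => F z) (z₀ := ⟨(false, u₀, 0), hz₀ false⟩) (hgc.comp continuous_subtype_val)
    (hFc.comp continuous_subtype_val)
    (fun z w => (hrel2 z z.2 w w.2).trans (hrel1 z z.2 w w.2).symm) ?_ ?_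
  · rw [← image_eq_range, hg, ← image_image (proj σ)]
    refine image_mem_nhds_of_isClosedMap (isClosedMap_proj σ) (proj_surjective σ) fun q hq => ?_
    have hloc : ∀ b : Bool, (fun z => sectorPoint σ (δ, z)) '' K ∈ 𝓝 (sectorPoint σ (δ, b, u₀, 0)) := by
      intro b
      have hev : ∀ᶠ x : Circle × unitInterval in 𝓝 ((if b then -u₀ else u₀), (0 : unitInterval)),
          ε ≤ ((if b then -x.1 else x.1 : Circle) : ℂ).im ∧ (x.2 : ℝ) ≤ 1 / 4 := by
        have h1 : Continuous fun x : Circle × unitInterval =>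
            ((if b then -x.1 else x.1 : Circle) : ℂ).im := by
          cases b
          · exact him.comp continuous_fst
          · exact him.comp continuous_fst.neg
        refine (h1.continuousAt.eventually (lt_mem_nhds (?_ : ε < _)) |>.mono fun _ h => h.le).and ?_
        · cases b <;> simpa using hε
        · exact (continuous_subtype_val.comp continuous_snd).continuousAt.eventually
            (Iic_mem_nhds (by norm_num))
      filter_upwards [eventually_exists_annulusPoint (δ := if b then σ δ else δ) hev]
      rintro q ⟨x, hx, rfl⟩
      refine ⟨(b, (if b then -x.1 else x.1), x.2), hx, ?_⟩
      cases b <;> simp [sectorPoint]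
    rcases exists_annulusPoint_zero_or q with ⟨δ', u', rfl⟩ | h
    · have hq' : boundaryLabel σ δ' u' = .arc δ u₀ := by
        have := (proj_annulusPoint_zero_eq_iff σ (by norm_num)).1 hq
        rw [this.2]
        exact boundaryLabel_of_pos σ δ hu₀
      rcases lt_trichotomy (u' : ℂ).im 0 with hu' | hu' | hu'
      · rw [boundaryLabel_of_neg σ _ hu'] at hq'
        injection hq' with h1 h2
        have hs : sectorPoint σ (δ, true, u₀, 0) = annulusPoint δ' u' 0 := by
          simp [sectorPoint, ← h1, ← h2]
        exact hs ▸ hloc true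
      · obtain ⟨c, hc⟩ := exists_boundaryLabel_eq_corner σ δ' hu'
        rw [hc] at hq'
        cases hq'
      · rw [boundaryLabel_of_pos σ _ hu'] at hq'
        injection hq' with h1 h2
        rw [h1, h2]
        exact hloc false
    · rw [proj_eq_iff, label_of_mem_Ioo σ h] at hq
      exact absurd ((label_annulusPoint_zero σ δ u₀).symm.trans hq.symm) (boundaryLabel_ne_inner σ _ _ _)
  -- On the upper arc, `re² < 1 - ε²` says that the imaginary part exceeds `ε`.
  · have ho : IsOpen {w : ℂ | w.re ^ 2 < 1 - ε ^ 2 ∧ |w.im| < 1 / 4} := by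
      refine IsOpen.and ?_ ?_
      · exact isOpen_lt (by fun_prop) continuous_const
      · exact isOpen_lt (by fun_prop) continuous_const
    rw [← image_eq_range]
    refine mem_of_superset (ho.mem_nhds ?_) ?_
    · constructor
      · have := circle_re_sq_add_im_sq u₀
        simp only [hF]
        nlinarith
      · simp [hF]
    · rintro w ⟨hw1, hw2⟩
      rw [abs_lt] at hw2
      obtain ⟨u, hu1, hu2⟩ := exists_circle_coe_eq (x := w.re) (y := √(1 - w.re ^ 2)) (by
        rw [Real.sq_sqrt (by nlinarith)]
        ring)
      have hε2 : ε ≤ (u : ℂ).im := by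
        rw [hu2]
        exact Real.le_sqrt_of_sq_le (by linarith)
      rcases le_total 0 w.im with h | h
      · exact ⟨(false, u, ⟨w.im, h, by linarith⟩), ⟨hε2, hw2.2.le⟩, Complex.ext hu1 rfl⟩
      · exact ⟨(true, u, ⟨-w.im, by linarith, by linarith⟩), ⟨hε2, by simp only; linarith⟩,
          Complex.ext hu1 (neg_neg _)⟩

end SectorCharts

/-! ### Coordinates at the corners -/

section CornerCharts

variable {n : ℕ} (σ : Equiv.Perm (Dart n))

/-- The half-plane coordinate of a sector, with the two kinds of sectors mirrored. -/
def halfPlaneCoord (z : Sector n) : ℂ :=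
  ⟨z.2.2.2, if z.2.1 then (z.2.2.1 : ℂ).im else -(z.2.2.1 : ℂ).im⟩

theorem continuous_halfPlaneCoord : Continuous (halfPlaneCoord (n := n)) := by
  have him : Continuous fun u : Circle => (u : ℂ).im :=
    Complex.continuous_im.comp continuous_induced_dom
  refine continuous_prod_of_discrete_left.2 fun δ => continuous_prod_of_discrete_left.2 fun b => ?_
  refine Complex.equivRealProdCLM.symm.continuous.comp
    ((continuous_subtype_val.comp continuous_snd).prodMk ?_)
  cases b
  · exact (him.comp continuous_fst).neg
  · exact him.comp continuous_fst

/-- The rotation by which the mirrored sectors are turned. -/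
noncomputable def mirrorFactor (m : ℕ) : ℂ := Complex.exp (-(Real.pi * Complex.I / m))

theorem mirrorFactor_pow {m : ℕ} (hm : m ≠ 0) : mirrorFactor m ^ m = -1 := by
  rw [mirrorFactor, ← Complex.exp_nat_mul, mul_neg, mul_div_cancel₀ _ (by exact_mod_cast hm),
    Complex.exp_neg, Complex.exp_pi_mul_I]
  norm_num

theorem mirrorFactor_ne_zero (m : ℕ) : mirrorFactor m ≠ 0 := Complex.exp_ne_zero _

/-- The coordinate of a sector at a corner with `2 m` sectors, where `κ` numbers the sectors. -/
noncomputable def cornerCoord (m : ℕ) (κ : Dart n → ℂ) (z : Sector n) : ℂ :=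
  κ z.1 * ((if z.2.1 then mirrorFactor m else 1) * halfPlaneCoord z ^ (m : ℂ)⁻¹)

theorem continuous_cornerCoord {m : ℕ} (hm : m ≠ 0) (κ : Dart n → ℂ) :
    Continuous (cornerCoord m κ) := by
  have h1 : Continuous fun z : Sector n => halfPlaneCoord z ^ (m : ℂ)⁻¹ := by
    refine continuous_iff_continuousAt.2 fun z => ?_
    refine (Complex.continuousAt_cpow_const_of_re_pos (Or.inl z.2.2.2.2.1) ?_).comp
      (f := halfPlaneCoord) continuous_halfPlaneCoord.continuousAt
    rw [← Complex.ofReal_natCast, ← Complex.ofReal_inv, Complex.ofReal_re]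
    positivity
  have h2 : Continuous fun z : Sector n => κ z.1 := continuous_of_discreteTopology.comp continuous_fst
  have h3 : Continuous fun z : Sector n => (if z.2.1 then mirrorFactor m else 1 : ℂ) :=
    (continuous_of_discreteTopology (f := fun b : Bool => if b then mirrorFactor m else 1)).comp
      (continuous_fst.comp continuous_snd)
  exact h2.mul (h3.mul h1)

/-- Coincidence of two sector points at the same corner, in sector coordinates. -/
def SectorRel (z w : Sector n) : Prop :=
  z.2.2 = w.2.2 ∧ ((z.1 = w.1 ∧ z.2.1 = w.2.1) ∨ z.2.2.2 = 0 ∧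
    ((0 < (z.2.2.1 : ℂ).im ∧ z.1 = w.1) ∨ (z.2.2.1 : ℂ).im = 0 ∨
      (z.2.2.1 : ℂ).im < 0 ∧ (z.2.1 = false ∧ w.2.1 = true ∧ z.1 = σ (σ w.1) ∨
        z.2.1 = true ∧ w.2.1 = false ∧ w.1 = σ (σ z.1))))

/-- Positive real parts confine the sectors to one corner: they exclude `u = -u'`, and `im u = 0`
then means `u = 1`. Arcs with `im u > 0` join the two sectors of one dart; those with `im u < 0`
join sectors of consecutive darts in the cycle of `σ * σ`. -/
theorem proj_sectorPoint_eq_iff {z w : Sector n} (hz : (z.2.2.2 : ℝ) ≤ 1 / 4)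
    (hw : (w.2.2.2 : ℝ) ≤ 1 / 4) (hzu : 0 < (z.2.2.1 : ℂ).re) (hwu : 0 < (w.2.2.1 : ℂ).re)
    (hc : (σ * σ).SameCycle z.1 w.1) :
    proj σ (sectorPoint σ z) = proj σ (sectorPoint σ w) ↔ SectorRel σ z w := by
  obtain ⟨δ, b, u, r⟩ := z
  obtain ⟨δ', b', u', r'⟩ := w
  simp only at hz hw hzu hwu hc
  rcases r.2.1.eq_or_lt with h0 | h0
  · obtain rfl : r = 0 := Subtype.ext h0.symm
    refine (proj_annulusPoint_zero_eq_iff σ hw).trans ?_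
    have huu : (u : ℂ).im = 0 → u = 1 := fun h =>
      circle_ext_of_re_pos hzu (by simp) (by simp [h])
    have huu' : (u' : ℂ).im = 0 → u' = 1 := fun h =>
      circle_ext_of_re_pos hwu (by simp) (by simp [h])
    simp only [SectorRel, Prod.mk.injEq, true_and]
    rw [and_comm (a := u = u'), and_assoc, eq_comm (a := r')]
    refine and_congr_right fun _ => ?_
    have hneg : u ≠ -u' := by
      rintro rfl
      rw [Circle.coe_neg, Complex.neg_re] at hzu
      linarith
    have hneg' : -u ≠ u' := fun h => hneg (by rw [← h, neg_neg])
    have hsign : (u : ℂ).im ≠ (u' : ℂ).im → u ≠ u' := fun h h' => h (by rw [h'])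
    have hcorner : ∀ (δ : Dart n) (b : Bool) (u : Circle), (u : ℂ).im = 0 → u = 1 →
        boundaryLabel σ (if b then σ δ else δ) (if b then -u else u) = .corner (cornerOf σ δ) := by
      rintro δ b u h rfl
      rw [boundaryLabel_sector_of_nonneg σ _ _ h.ge, boundaryLabel_one]
    rcases lt_trichotomy (u : ℂ).im 0 with hu | hu | hu
    · rw [boundaryLabel_sector_of_neg σ _ _ hu]
      rcases lt_trichotomy (u' : ℂ).im 0 with hu' | hu' | hu'
      · rw [boundaryLabel_sector_of_neg σ _ _ hu']
        cases b <;> cases b' <;>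
          simp [hu, hu.not_gt, hu.ne, and_comm, Equiv.symm_apply_eq, Equiv.eq_symm_apply,
            eq_comm (a := δ')]
      · rw [hcorner _ _ _ hu' (huu' hu')]
        simp [hsign (by linarith : _ < _).ne]
      · rw [boundaryLabel_sector_of_nonneg σ _ _ hu'.le, boundaryLabel_of_pos σ _ hu']
        simp [hsign (by linarith : _ < _).ne, hneg']
    · rw [hcorner _ _ _ hu (huu hu)]
      rcases lt_trichotomy (u' : ℂ).im 0 with hu' | hu' | hu'
      · rw [boundaryLabel_sector_of_neg σ _ _ hu']
        simp [hsign (by linarith : _ < _).ne']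
      · rw [hcorner _ _ _ hu' (huu' hu')]
        simp [huu hu, huu' hu', (cornerOf_eq_iff σ).2 hc]
      · rw [boundaryLabel_sector_of_nonneg σ _ _ hu'.le, boundaryLabel_of_pos σ _ hu']
        simp [hsign (by linarith : _ < _).ne]
    · rw [boundaryLabel_sector_of_nonneg σ _ _ hu.le, boundaryLabel_of_pos σ _ hu]
      rcases lt_trichotomy (u' : ℂ).im 0 with hu' | hu' | hu'
      · rw [boundaryLabel_sector_of_neg σ _ _ hu']
        simp [hsign (by linarith : _ < _).ne', hneg]
      · rw [hcorner _ _ _ hu' (huu' hu')]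
        simp [hsign (by linarith : _ < _).ne']
      · rw [boundaryLabel_sector_of_nonneg σ _ _ hu'.le, boundaryLabel_of_pos σ _ hu']
        simp only [Label.arc.injEq, hu, hu.ne', hu.not_gt]
        tauto
  · refine (proj_annulusPoint_eq_iff_of_pos σ hz hw h0).trans ?_
    have hne : r ≠ 0 := fun h => by rw [h] at h0; exact lt_irrefl _ h0
    have h1 : u ≠ -u' := by
      rintro rfl
      rw [Circle.coe_neg, Complex.neg_re] at hzu
      linarith
    have h2 : -u ≠ u' := fun h => h1 (by rw [← h, neg_neg])
    cases b <;> cases b' <;> simp [SectorRel, hne, h1, h2, and_comm]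

variable {σ} {m : ℕ} {κ : Dart n → ℂ}

/-- The power forgets `κ`, hence the dart, but retains `im u` and the signed height. -/
theorem cornerCoord_pow (hm : m ≠ 0) {z : Sector n} (hκ : κ z.1 ^ m = 1) :
    cornerCoord m κ z ^ m = ⟨if z.2.1 then -z.2.2.2 else z.2.2.2, -(z.2.2.1 : ℂ).im⟩ := by
  rw [cornerCoord, mul_pow, hκ, one_mul, mul_pow, Complex.cpow_nat_inv_pow _ hm]
  obtain ⟨δ, b, u, r⟩ := z
  cases b
  · simp [halfPlaneCoord]
  · simp only [if_true, mirrorFactor_pow hm, halfPlaneCoord]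
    apply Complex.ext <;> simp

theorem halfPlaneCoord_zero (δ : Dart n) (b : Bool) (u : Circle) :
    halfPlaneCoord (δ, b, u, 0) =
      ((if b then (u : ℂ).im else -(u : ℂ).im : ℝ) : ℂ) * Complex.I := by
  apply Complex.ext <;> simp [halfPlaneCoord]

theorem halfPlaneCoord_ne_zero {z : Sector n} (h : z.2.2.2 = 0 → (z.2.2.1 : ℂ).im ≠ 0) :
    halfPlaneCoord z ≠ 0 := by
  intro h0
  have h1 : (z.2.2.2 : ℝ) = 0 := congrArg Complex.re h0
  have h2 : (if z.2.1 then (z.2.2.1 : ℂ).im else -(z.2.2.1 : ℂ).im) = 0 := congrArg Complex.im h0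
  refine h (Subtype.ext h1) ?_
  split_ifs at h2
  · exact h2
  · exact neg_eq_zero.1 h2

theorem cornerCoord_eq_of_im_pos (δ : Dart n) (b b' : Bool) {u : Circle} (hu : 0 < (u : ℂ).im) :
    cornerCoord m κ (δ, b, u, 0) = cornerCoord m κ (δ, b', u, 0) := by
  have h := mul_I_cpow_inv (m := m) hu
  cases b <;> cases b' <;> simp [cornerCoord, halfPlaneCoord_zero, h, mirrorFactor]

/-- `mirrorFactor` occurs once from the mirrored sector and once from the branches of the root; its
square is the step of `κ` along the cycle. -/
theorem cornerCoord_eq_of_im_neg {δ : Dart n} {u : Circle} (hu : (u : ℂ).im < 0)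
    (hκ : κ (σ (σ δ)) = κ δ * mirrorFactor m ^ 2) :
    cornerCoord m κ (σ (σ δ), false, u, 0) = cornerCoord m κ (δ, true, u, 0) := by
  have h := mul_I_cpow_inv (m := m) (neg_pos.2 hu)
  rw [Complex.ofReal_neg, neg_mul, neg_neg] at h
  simp only [cornerCoord, halfPlaneCoord_zero, if_true, h, hκ, Bool.false_eq_true, if_false,
    Complex.ofReal_neg, neg_mul, mirrorFactor]
  ring

theorem cornerCoord_eq_of_sectorRel {z w : Sector n}
    (hm : m ≠ 0) (hκ : ∀ a, (σ * σ).SameCycle z.1 a → κ (σ (σ a)) = κ a * mirrorFactor m ^ 2)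
    (hc : (σ * σ).SameCycle z.1 w.1)
    (h : SectorRel σ z w) : cornerCoord m κ z = cornerCoord m κ w := by
  obtain ⟨δ, b, u, r⟩ := z
  obtain ⟨δ', b', u', r'⟩ := w
  obtain ⟨h, h'⟩ := h
  simp only [Prod.mk.injEq] at h hc hκ
  obtain ⟨rfl, rfl⟩ := h
  simp only at h'
  have hinv : (m : ℂ)⁻¹ ≠ 0 := inv_ne_zero (by exact_mod_cast hm)
  rcases h' with ⟨rfl, rfl⟩ | ⟨rfl, ⟨h1, rfl⟩ | h1 | ⟨h1, ⟨rfl, rfl, rfl⟩ | ⟨rfl, rfl, rfl⟩⟩⟩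
  · rfl
  · exact cornerCoord_eq_of_im_pos _ _ _ h1
  · simp [cornerCoord, halfPlaneCoord_zero, h1, Complex.zero_cpow hinv]
  · exact cornerCoord_eq_of_im_neg h1 (hκ _ hc)
  · exact (cornerCoord_eq_of_im_neg h1 (hκ _ (Equiv.Perm.SameCycle.refl _ _))).symm

theorem eq_of_cornerCoord_eq {δ δ' : Dart n} {b : Bool} {u : Circle} {r : unitInterval}
    (h0 : r = 0 → (u : ℂ).im ≠ 0)
    (h : cornerCoord m κ (δ, b, u, r) = cornerCoord m κ (δ', b, u, r)) : κ δ = κ δ' := by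
  refine mul_right_cancel₀ (b := (if b then mirrorFactor m else 1) *
    halfPlaneCoord (δ, b, u, r) ^ (m : ℂ)⁻¹) (mul_ne_zero ?_ ?_) h
  · split_ifs
    · exact mirrorFactor_ne_zero m
    · exact one_ne_zero
  · exact fun h1 => halfPlaneCoord_ne_zero h0 ((Complex.cpow_eq_zero_iff _ _).1 h1).1

/-- The `m`-th powers determine `u` and the signed height. What remains of the coordinate is a
common nonzero factor times `κ`, which is injective on the cycle; at the corner itself the factor
vanishes and nothing is to be shown. -/
theorem sectorRel_of_cornerCoord_eq {z w : Sector n} (hzu : 0 < (z.2.2.1 : ℂ).re)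
    (hwu : 0 < (w.2.2.1 : ℂ).re)
    (hm : m ≠ 0) (hκ : ∀ a, (σ * σ).SameCycle z.1 a → κ (σ (σ a)) = κ a * mirrorFactor m ^ 2)
    (hκ1 : ∀ a, (σ * σ).SameCycle z.1 a → κ a ^ m = 1)
    (hκi : ∀ a b, (σ * σ).SameCycle z.1 a → (σ * σ).SameCycle z.1 b → κ a = κ b → a = b)
    (hc : (σ * σ).SameCycle z.1 w.1)
    (h : cornerCoord m κ z = cornerCoord m κ w) : SectorRel σ z w := by
  have hp := cornerCoord_pow hm (hκ1 z.1 (Equiv.Perm.SameCycle.refl _ _))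
  rw [h, cornerCoord_pow hm (hκ1 w.1 hc)] at hp
  obtain ⟨δ, b, u, r⟩ := z
  obtain ⟨δ', b', u', r'⟩ := w
  simp only at hzu hwu hκ hκ1 hκi hc h hp
  have hδ := Equiv.Perm.SameCycle.refl (σ * σ) δ
  have hσ : ∀ a, (σ * σ).SameCycle δ a → (σ * σ).SameCycle δ (σ (σ a)) := fun a ha =>
    Equiv.Perm.sameCycle_apply_right.2 ha
  have hre := congrArg Complex.re hp
  have him := congrArg Complex.im hp
  simp only at hre him
  obtain rfl : u = u' := circle_ext_of_re_pos hzu hwu (by linarith)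
  have hr0 := r.2.1
  have hr0' := r'.2.1
  by_cases hb : b = b'
  · subst hb
    obtain rfl : r = r' := Subtype.ext (by split_ifs at hre <;> linarith)
    refine ⟨rfl, ?_⟩
    by_cases h0 : r = 0 ∧ (u : ℂ).im = 0
    · exact Or.inr ⟨h0.1, Or.inr (Or.inl h0.2)⟩
    · exact Or.inl ⟨hκi _ _ hδ hc (eq_of_cornerCoord_eq (not_and.1 h0) h), rfl⟩
  -- Sectors of opposite kinds have heights of opposite sign, so they meet only at height zero.
  · have hr : (r : ℝ) = -r' := by
      cases b <;> cases b' <;> simp at hb hre <;> linarith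
    obtain rfl : r = 0 := Subtype.ext (by simp only [Icc.coe_zero]; linarith)
    obtain rfl : r' = 0 := Subtype.ext (by simp only [Icc.coe_zero] at hr ⊢; linarith)
    refine ⟨rfl, Or.inr ⟨rfl, ?_⟩⟩
    rcases lt_trichotomy (u : ℂ).im 0 with hu | hu | hu
    · refine Or.inr (Or.inr ⟨hu, ?_⟩)
      cases b <;> cases b' <;> simp at hb ⊢
      · rw [← cornerCoord_eq_of_im_neg hu (hκ _ hc)] at h
        exact hκi _ _ hδ (hσ _ hc) (eq_of_cornerCoord_eq (fun _ => hu.ne) h)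
      · rw [← cornerCoord_eq_of_im_neg hu (hκ _ hδ)] at h
        exact hκi _ _ hc (hσ _ hδ) (eq_of_cornerCoord_eq (fun _ => hu.ne) h.symm)
    · exact Or.inr (Or.inl hu)
    · rw [cornerCoord_eq_of_im_pos δ' b' b hu] at h
      exact Or.inl ⟨hu, hκi _ _ hδ hc (eq_of_cornerCoord_eq (fun _ => hu.ne') h)⟩

end CornerCharts

/-! ### The glued space is a closed surface -/

section ClosedSurface

variable {n : ℕ} (σ : Equiv.Perm (Dart n))

theorem sectorPoint_corner_mem_nhds (δ : Dart n) (b : Bool) :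
    ∀ᶠ q in 𝓝 (sectorPoint σ (δ, b, 1, 0)), ∃ u : Circle, ∃ r : unitInterval,
      1 / 2 ≤ (u : ℂ).re ∧ (r : ℝ) ≤ 1 / 4 ∧ sectorPoint σ (δ, b, u, r) = q := by
  have hre : Continuous fun u : Circle => (u : ℂ).re :=
    Complex.continuous_re.comp continuous_induced_dom
  have hev : ∀ᶠ x : Circle × unitInterval in 𝓝 ((if b then -1 else 1 : Circle), (0 : unitInterval)),
      1 / 2 ≤ ((if b then -x.1 else x.1 : Circle) : ℂ).re ∧ (x.2 : ℝ) ≤ 1 / 4 := by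
    have h1 : Continuous fun x : Circle × unitInterval =>
        ((if b then -x.1 else x.1 : Circle) : ℂ).re := by
      cases b
      · exact hre.comp continuous_fst
      · exact hre.comp continuous_fst.neg
    refine (h1.continuousAt.eventually (Ici_mem_nhds (?_ : (1 : ℝ) / 2 < _))).and ?_
    · cases b <;> norm_num
    · exact (continuous_subtype_val.comp continuous_snd).continuousAt.eventually
        (Iic_mem_nhds (by norm_num))
  filter_upwards [eventually_exists_annulusPoint (δ := if b then σ δ else δ) hev]
  rintro q ⟨x, hx, rfl⟩
  refine ⟨(if b then -x.1 else x.1), x.2, hx.1, hx.2, ?_⟩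
  cases b <;> simp [sectorPoint]

/-- Here `m` is the length of the cycle of `σ * σ` through `δ₀`. Its `2 m` half-discs, each reduced
to an angle `π / m`, fill a neighborhood of the origin and overlap exactly along the glued arcs. -/
theorem exists_chart_corner (δ₀ : Dart n) :
    ∃ e : OpenPartialHomeomorph (Surface σ) ℂ, proj σ (annulusPoint δ₀ 1 0) ∈ e.source := by
  obtain ⟨m, hm, κ, hκ1, hκi, hκ, hκs⟩ := exists_cycle_coordinate (σ * σ) δ₀
  have hinv : (m : ℂ)⁻¹ ≠ 0 := inv_ne_zero (by exact_mod_cast hm)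
  have hre : Continuous fun u : Circle => (u : ℂ).re :=
    Complex.continuous_re.comp continuous_induced_dom
  set K : Set (Sector n) := {z | (σ * σ).SameCycle δ₀ z.1 ∧ 1 / 2 ≤ (z.2.2.1 : ℂ).re ∧
    (z.2.2.2 : ℝ) ≤ 1 / 4} with hK
  have hKc : IsClosed K := by
    refine IsClosed.inter ((isClosed_discrete {a | (σ * σ).SameCycle δ₀ a}).preimage continuous_fst)
      (IsClosed.inter ?_ ?_)
    · exact isClosed_le continuous_const
        (hre.comp (continuous_fst.comp (continuous_snd.comp continuous_snd)))
    · exact isClosed_le (continuous_subtype_val.comp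
        (continuous_snd.comp (continuous_snd.comp continuous_snd))) continuous_const
  have : CompactSpace K := isCompact_iff_compactSpace.1 hKc.isCompact
  have hz₀ : (δ₀, false, 1, 0) ∈ K :=
    ⟨Equiv.Perm.SameCycle.refl _ _, by norm_num, by norm_num⟩
  have hrel : ∀ z ∈ K, ∀ w ∈ K, proj σ (sectorPoint σ z) = proj σ (sectorPoint σ w) ↔
      cornerCoord m κ z = cornerCoord m κ w := by
    rintro z ⟨hz1, hz2, hz3⟩ w ⟨hw1, hw2, hw3⟩
    have hzu : 0 < (z.2.2.1 : ℂ).re := by linarith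
    have hwu : 0 < (w.2.2.1 : ℂ).re := by linarith
    have hc := hz1.symm.trans hw1
    rw [proj_sectorPoint_eq_iff σ hz3 hw3 hzu hwu hc]
    exact ⟨cornerCoord_eq_of_sectorRel hm (fun a ha => hκ a (hz1.trans ha)) hc,
      sectorRel_of_cornerCoord_eq hzu hwu hm (fun a ha => hκ a (hz1.trans ha))
        (fun a ha => hκ1 a (hz1.trans ha))
        (fun a b ha hb => hκi a b (hz1.trans ha) (hz1.trans hb)) hc⟩
  refine exists_openPartialHomeomorph_of_compact (g := fun z : K => proj σ (sectorPoint σ z))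
    (F := fun z : K => cornerCoord m κ z) (z₀ := ⟨(δ₀, false, 1, 0), hz₀⟩)
    ((continuous_proj σ).comp ((continuous_sectorPoint σ).comp continuous_subtype_val))
    ((continuous_cornerCoord hm κ).comp continuous_subtype_val)
    (fun z w => hrel z z.2 w w.2) ?_ ?_
  · rw [← image_eq_range (fun z => proj σ (sectorPoint σ z)), ← image_image (proj σ)]
    refine image_mem_nhds_of_isClosedMap (isClosedMap_proj σ) (proj_surjective σ) fun q hq => ?_
    have hloc : ∀ δ b, (σ * σ).SameCycle δ₀ δ →
        sectorPoint σ '' K ∈ 𝓝 (sectorPoint σ (δ, b, 1, 0)) := by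
      intro δ b hδ
      filter_upwards [sectorPoint_corner_mem_nhds σ δ b]
      rintro q ⟨u, r, hu, hr, rfl⟩
      exact ⟨_, ⟨hδ, hu, hr⟩, rfl⟩
    rcases exists_annulusPoint_zero_or q with ⟨δ, u, rfl⟩ | h
    · have hq' : boundaryLabel σ δ u = .corner (cornerOf σ δ₀) := by
        rw [((proj_annulusPoint_zero_eq_iff σ (by norm_num)).1 hq).2]
        exact boundaryLabel_one σ δ₀
      have hu : (u : ℂ).im = 0 := by
        by_contra h
        obtain ⟨_, _, h⟩ := exists_boundaryLabel_eq_arc σ δ h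
        rw [hq'] at h
        cases h
      rcases eq_one_or_neg_one_of_im_eq_zero hu with rfl | rfl
      · rw [boundaryLabel_one] at hq'
        injection hq' with hq'
        exact hloc δ false ((cornerOf_eq_iff σ).1 hq'.symm)
      · rw [boundaryLabel_neg_one] at hq'
        injection hq' with hq'
        have hs : sectorPoint σ (σ.symm δ, true, 1, 0) = annulusPoint δ (-1) 0 := by
          simp [sectorPoint]
        refine hs ▸ hloc (σ.symm δ) true ((cornerOf_eq_iff σ).1 ?_)
        rw [← hq', ← cornerOf_apply_apply σ (σ.symm δ), Equiv.apply_symm_apply]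
    · rw [proj_eq_iff, label_of_mem_Ioo σ h] at hq
      exact absurd ((label_annulusPoint_zero σ δ₀ 1).symm.trans hq.symm)
        (boundaryLabel_ne_inner σ _ _ _)
  -- The bound gives a height below `1 / 4` and `|im u| < 1 / 4`, hence `re u ≥ 1 / 2`, as
  -- membership in `K` requires.
  · have ho : IsOpen {w : ℂ | ‖w ^ m‖ < 1 / 4} := isOpen_lt (by fun_prop) continuous_const
    rw [← image_eq_range (cornerCoord m κ)]
    refine mem_of_superset (ho.mem_nhds ?_) ?_
    · simp only [mem_ofPred_eq]
      rw [cornerCoord_pow hm (hκ1 δ₀ (Equiv.Perm.SameCycle.refl _ _))]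
      have : (⟨((0 : unitInterval) : ℝ), -((1 : Circle) : ℂ).im⟩ : ℂ) = 0 := by
        apply Complex.ext <;> simp
      simp only [Bool.false_eq_true, if_false, this]
      norm_num
    · intro w hw
      simp only [mem_ofPred_eq] at hw
      have hwre := abs_lt.1 ((Complex.abs_re_le_norm (w ^ m)).trans_lt hw)
      have hwim := abs_lt.1 ((Complex.abs_im_le_norm (w ^ m)).trans_lt hw)
      have hsq : (w ^ m).im ^ 2 ≤ 1 / 16 := by nlinarith
      obtain ⟨u, hu1, hu2⟩ := exists_circle_coe_eq (x := √(1 - (w ^ m).im ^ 2)) (y := -(w ^ m).im)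
        (by rw [Real.sq_sqrt (by linarith)]; ring)
      have hu : 1 / 2 ≤ (u : ℂ).re := by
        rw [hu1]
        exact Real.le_sqrt_of_sq_le (by linarith)
      obtain ⟨b, r, hr, hbr⟩ : ∃ b : Bool, ∃ r : unitInterval, (r : ℝ) ≤ 1 / 4 ∧
          (if b then -(r : ℝ) else r) = (w ^ m).re := by
        rcases le_total 0 (w ^ m).re with h | h
        · exact ⟨false, ⟨(w ^ m).re, h, by linarith⟩, hwre.2.le, rfl⟩
        · exact ⟨true, ⟨-(w ^ m).re, by linarith, by linarith⟩, by simp only; linarith, neg_neg _⟩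
      have hpow : ∀ a, (σ * σ).SameCycle δ₀ a → cornerCoord m κ (a, b, u, r) ^ m = w ^ m := by
        intro a ha
        rw [cornerCoord_pow hm (hκ1 a ha)]
        exact Complex.ext hbr (by rw [hu2, neg_neg])
      have hfac : ∀ a, cornerCoord m κ (a, b, u, r) = κ a * ((if b then mirrorFactor m else 1) *
          halfPlaneCoord (δ₀, b, u, r) ^ (m : ℂ)⁻¹) := fun a => rfl
      set c := (if b then mirrorFactor m else 1) * halfPlaneCoord (δ₀, b, u, r) ^ (m : ℂ)⁻¹
      have h0 := hpow δ₀ (Equiv.Perm.SameCycle.refl _ _)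
      rw [hfac, mul_pow, hκ1 δ₀ (Equiv.Perm.SameCycle.refl _ _), one_mul] at h0
      rcases eq_or_ne c 0 with hc | hc
      · refine ⟨(δ₀, b, u, r), ⟨Equiv.Perm.SameCycle.refl _ _, hu, hr⟩, ?_⟩
        rw [hfac, hc, mul_zero]
        rw [hc, zero_pow hm] at h0
        exact (pow_eq_zero_iff hm |>.1 h0.symm).symm
      -- `w` and `c` have the same `m`-th power, so their quotient is a root of unity and selects
      -- the dart.
      · obtain ⟨a, ha, haw⟩ := hκs (w / c) (by rw [div_pow, h0, div_self (h0 ▸ pow_ne_zero m hc)])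
        exact ⟨(a, b, u, r), ⟨ha, hu, hr⟩, by rw [hfac, haw, div_mul_cancel₀ _ hc]⟩

theorem isClosedSurface_surface : IsClosedSurface (Surface σ) where
  t2 := inferInstance
  compact := inferInstance
  charted := by
    refine nonempty_chartedSpace_of_complex fun s => ?_
    obtain ⟨p, rfl⟩ := proj_surjective σ s
    rcases exists_annulusPoint_zero_or p with ⟨δ, u, rfl⟩ | h
    · rcases lt_trichotomy (u : ℂ).im 0 with hu | hu | hu
      · have : proj σ (annulusPoint δ u 0) = proj σ (annulusPoint (σ.symm δ) (-u) 0) := by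
          have hu' : 0 < ((-u : Circle) : ℂ).im := by simpa using hu
          rw [proj_eq_iff, label_annulusPoint_zero, label_annulusPoint_zero,
            boundaryLabel_of_neg σ _ hu, boundaryLabel_of_pos σ _ hu']
        rw [this]
        exact exists_chart_arc σ _ (by simpa using hu)
      · rcases eq_one_or_neg_one_of_im_eq_zero hu with rfl | rfl
        · exact exists_chart_corner σ δ
        · have : proj σ (annulusPoint δ (-1) 0) = proj σ (annulusPoint (σ δ) 1 0) := by
            rw [proj_eq_iff, label_annulusPoint_zero, label_annulusPoint_zero, boundaryLabel_one,
              boundaryLabel_neg_one]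
          rw [this]
          exact exists_chart_corner σ (σ δ)
      · exact exists_chart_arc σ δ hu
    · exact exists_chart_inner σ h

end ClosedSurface

/-! ### The flow on the surface -/

section Flow

variable {n : ℕ}

/-- The flow on the annuli, a rotation on the interior circles. -/
noncomputable def annuliMap (t : ℝ) (p : Annuli n) : Annuli n :=
  (p.1, rot ((p.2.2 : ℝ) * (1 - p.2.2)) t p.2.1, p.2.2)

theorem continuous_annuliMap : Continuous fun x : ℝ × Annuli n => annuliMap x.1 x.2 := by
  have h : Continuous fun x : ℝ × Annuli n =>
      ((x.2.2.2 : ℝ) * (1 - x.2.2.2), x.1, x.2.2.1) := by fun_prop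
  exact (by fun_prop : Continuous fun x : ℝ × Annuli n => x.2.1).prodMk
    ((continuous_rot.comp h).prodMk (by fun_prop))

theorem annuliMap_zero (p : Annuli n) : annuliMap 0 p = p := by
  rw [annuliMap, rot_zero_right]

theorem annuliMap_add (s t : ℝ) (p : Annuli n) :
    annuliMap (s + t) p = annuliMap s (annuliMap t p) := by
  rw [annuliMap, rot_add]
  rfl

theorem annuliMap_annulusPoint_zero (t : ℝ) (δ : Dart n) (u : Circle) :
    annuliMap t (annulusPoint δ u 0) = annulusPoint δ (rot 0 t u) 0 := by
  obtain ⟨e, b⟩ := δ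
  cases b <;> simp [annuliMap, annulusPoint, height]

variable (σ : Equiv.Perm (Dart n))

/-- The flow in terms of labels. -/
noncomputable def labelMap (t : ℝ) : Label σ → Label σ
  | .inner p => .inner (annuliMap t p)
  | .arc δ u => .arc δ (rot 0 t u)
  | .corner c => .corner c

/-- The flow respects the gluing because on boundary circles it commutes with negation, keeps the
sign of the imaginary part and fixes `±1`. -/
theorem label_annuliMap (t : ℝ) (p : Annuli n) :
    label σ (annuliMap t p) = labelMap σ t (label σ p) := by
  rcases exists_annulusPoint_zero_or p with ⟨δ, u, rfl⟩ | h
  · rw [annuliMap_annulusPoint_zero, label_annulusPoint_zero, label_annulusPoint_zero]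
    rcases lt_trichotomy (u : ℂ).im 0 with hu | hu | hu
    · have hu' : 0 < ((-u : Circle) : ℂ).im := by simpa using hu
      have h1 := im_rot_zero_pos hu' t
      rw [rot_neg, Circle.coe_neg, Complex.neg_im, neg_pos] at h1
      rw [boundaryLabel_of_neg σ _ hu, boundaryLabel_of_neg σ _ h1, labelMap, rot_neg]
    · rcases eq_one_or_neg_one_of_im_eq_zero hu with rfl | rfl
      · rw [rot_zero_one, boundaryLabel_one, labelMap]
      · rw [rot_zero_neg_one, boundaryLabel_neg_one, labelMap]
    · rw [boundaryLabel_of_pos σ _ hu, boundaryLabel_of_pos σ _ (im_rot_zero_pos hu t), labelMap]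
  · rw [label_of_mem_Ioo σ h, labelMap, label_of_mem_Ioo σ (p := annuliMap t p) h]

/-- The flow on the surface. -/
noncomputable def surfaceFlow : Flow ℝ (Surface σ) where
  toFun t := Quotient.map (annuliMap t) fun p q h => by
    change label σ _ = label σ _
    rw [label_annuliMap, label_annuliMap, (show label σ p = label σ q from h)]
  cont' := by
    -- A product of a quotient map with the identity need not be a quotient map; properness of
    -- `proj` makes it one.
    have hp : IsProperMap (Prod.map id (proj σ) : ℝ × Annuli n → ℝ × Surface σ) :=
      isProperMap_id.prodMap (continuous_proj σ).isProperMap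
    have hq := hp.isClosedMap.isQuotientMap hp.continuous
      (Function.surjective_id.prodMap (proj_surjective σ))
    rw [hq.continuous_iff]
    exact (continuous_proj σ).comp continuous_annuliMap
  map_add' s t x := by
    obtain ⟨p, rfl⟩ := proj_surjective σ x
    exact congrArg (proj σ) (annuliMap_add s t p)
  map_zero' x := by
    obtain ⟨p, rfl⟩ := proj_surjective σ x
    exact congrArg (proj σ) (annuliMap_zero p)

theorem surfaceFlow_proj (t : ℝ) (p : Annuli n) :
    surfaceFlow σ t (proj σ p) = proj σ (annuliMap t p) := rfl

/-- The point `u` of the boundary circle `δ`, as a point of the surface. -/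
noncomputable def boundaryPoint (δ : Dart n) (u : Circle) : Surface σ := proj σ (annulusPoint δ u 0)

theorem continuous_boundaryPoint (δ : Dart n) : Continuous (boundaryPoint σ δ) :=
  (continuous_proj σ).comp ((continuous_annulusPoint δ).comp (continuous_id.prodMk continuous_const))

theorem surfaceFlow_boundaryPoint (t : ℝ) (δ : Dart n) (u : Circle) :
    surfaceFlow σ t (boundaryPoint σ δ u) = boundaryPoint σ δ (rot 0 t u) := by
  rw [boundaryPoint, surfaceFlow_proj, annuliMap_annulusPoint_zero, boundaryPoint]

theorem boundaryPoint_eq_iff {δ δ' : Dart n} {u u' : Circle} :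
    boundaryPoint σ δ u = boundaryPoint σ δ' u' ↔
      boundaryLabel σ δ u = boundaryLabel σ δ' u' := by
  rw [boundaryPoint, boundaryPoint, proj_eq_iff, label_annulusPoint_zero, label_annulusPoint_zero]

theorem boundaryPoint_neg_one (δ : Dart n) :
    boundaryPoint σ δ (-1) = boundaryPoint σ (σ δ) 1 := by
  rw [boundaryPoint_eq_iff, boundaryLabel_one, boundaryLabel_neg_one]

theorem boundaryPoint_eq_neg (δ : Dart n) {u : Circle} (hu : (u : ℂ).im < 0) :
    boundaryPoint σ δ u = boundaryPoint σ (σ.symm δ) (-u) := by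
  rw [boundaryPoint_eq_iff, boundaryLabel_of_neg σ _ hu,
    boundaryLabel_of_pos σ _ (by simpa using hu)]

theorem boundaryPoint_arc_eq_iff {δ δ' : Dart n} {u u' : Circle} (hu : 0 < (u : ℂ).im)
    (hu' : 0 < (u' : ℂ).im) :
    boundaryPoint σ δ u = boundaryPoint σ δ' u' ↔ δ = δ' ∧ u = u' := by
  rw [boundaryPoint_eq_iff, boundaryLabel_of_pos σ _ hu, boundaryLabel_of_pos σ _ hu',
    Label.arc.injEq]

theorem boundaryPoint_arc_ne_corner {δ δ' : Dart n} {u : Circle} (hu : 0 < (u : ℂ).im) :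
    boundaryPoint σ δ u ≠ boundaryPoint σ δ' 1 := by
  rw [Ne, boundaryPoint_eq_iff, boundaryLabel_of_pos σ _ hu, boundaryLabel_one]
  exact fun h => by cases h

/-- The points of the surface in the interior of the annuli. -/
def innerSet : Set (Surface σ) := proj σ '' {p | (p.2.2 : ℝ) ∈ Ioo (0 : ℝ) 1}

theorem proj_injOn_inner {p q : Annuli n} (hp : (p.2.2 : ℝ) ∈ Ioo (0 : ℝ) 1)
    (h : proj σ p = proj σ q) : p = q := by
  rw [proj_eq_iff, label_of_mem_Ioo σ hp] at h
  rcases exists_annulusPoint_zero_or q with ⟨δ, u, rfl⟩ | hq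
  · rw [label_annulusPoint_zero] at h
    exact absurd h.symm (boundaryLabel_ne_inner σ _ _ _)
  · rw [label_of_mem_Ioo σ hq] at h
    injection h

theorem boundaryPoint_notMem_innerSet (δ : Dart n) (u : Circle) :
    boundaryPoint σ δ u ∉ innerSet σ := by
  rintro ⟨p, hp, h⟩
  have := proj_injOn_inner σ hp h
  rw [this] at hp
  obtain ⟨e, b⟩ := δ
  cases b <;> simp [annulusPoint, height] at hp

theorem mem_innerSet_or_exists_boundaryPoint (s : Surface σ) :
    s ∈ innerSet σ ∨ ∃ δ u, s = boundaryPoint σ δ u := by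
  obtain ⟨p, rfl⟩ := proj_surjective σ s
  rcases exists_annulusPoint_zero_or p with ⟨δ, u, rfl⟩ | h
  · exact Or.inr ⟨δ, u, rfl⟩
  · exact Or.inl ⟨p, h, rfl⟩

theorem surface_cases (s : Surface σ) : s ∈ innerSet σ ∨
    (∃ δ, ∃ u : Circle, 0 < (u : ℂ).im ∧ s = boundaryPoint σ δ u) ∨ ∃ δ, s = boundaryPoint σ δ 1 := by
  rcases mem_innerSet_or_exists_boundaryPoint σ s with h | ⟨δ, u, rfl⟩
  · exact Or.inl h
  · rcases lt_trichotomy (u : ℂ).im 0 with hu | hu | hu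
    · exact Or.inr (Or.inl ⟨σ.symm δ, -u, by simpa using hu, boundaryPoint_eq_neg σ δ hu⟩)
    · rcases eq_one_or_neg_one_of_im_eq_zero hu with rfl | rfl
      · exact Or.inr (Or.inr ⟨δ, rfl⟩)
      · exact Or.inr (Or.inr ⟨σ δ, boundaryPoint_neg_one σ δ⟩)
    · exact Or.inr (Or.inl ⟨δ, u, hu, rfl⟩)

theorem proj_preimage_innerSet :
    proj σ ⁻¹' innerSet σ = {p | (p.2.2 : ℝ) ∈ Ioo (0 : ℝ) 1} := by
  refine Subset.antisymm ?_ (subset_preimage_image _ _)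
  rintro p ⟨q, hq, h⟩
  exact proj_injOn_inner σ hq h ▸ hq

theorem isOpen_innerSet : IsOpen (innerSet σ) := by
  rw [← (isQuotientMap_proj σ).isOpen_preimage, proj_preimage_innerSet]
  exact isOpen_Ioo.preimage (by fun_prop)

theorem boundaryPoint_mem_closure (δ : Dart n) (u : Circle) :
    boundaryPoint σ δ u ∈ closure (proj σ '' {p | p.1 = δ.1 ∧ (p.2.2 : ℝ) ∈ Ioo (0 : ℝ) 1}) := by
  have hc : Continuous fun r : ℝ => proj σ (annulusPoint δ u (projIcc (0 : ℝ) 1 zero_le_one r)) :=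
    (continuous_proj σ).comp ((continuous_annulusPoint δ).comp
      (continuous_const.prodMk (continuous_projIcc (h := zero_le_one))))
  have h0 : boundaryPoint σ δ u = proj σ (annulusPoint δ u (projIcc (0 : ℝ) 1 zero_le_one 0)) := by
    rw [projIcc_left]
    rfl
  rw [h0]
  have hcl : (0 : ℝ) ∈ closure (Ioo (0 : ℝ) 1) := by
    rw [closure_Ioo zero_ne_one]
    exact ⟨le_rfl, zero_le_one⟩
  refine closure_mono ?_ (image_closure_subset_closure_image hc ⟨0, hcl, rfl⟩)
  rintro _ ⟨r, hr, rfl⟩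
  refine ⟨_, ⟨rfl, height_mem_Ioo ?_⟩, rfl⟩
  rwa [projIcc_of_mem zero_le_one (Ioo_subset_Icc_self hr)]

theorem dense_innerSet : Dense (innerSet σ) := by
  intro s
  rcases mem_innerSet_or_exists_boundaryPoint σ s with h | ⟨δ, u, rfl⟩
  · exact subset_closure h
  · exact closure_mono (image_mono fun p hp => hp.2) (boundaryPoint_mem_closure σ δ u)

end Flow

/-! ### Periodic orbits, saddles, diagram and edge region -/

section Dynamics

variable {n : ℕ} (σ : Equiv.Perm (Dart n))

theorem surfaceFlow_mem_innerSet {s : Surface σ} (hs : s ∈ innerSet σ) (t : ℝ) :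
    surfaceFlow σ t s ∈ innerSet σ := by
  obtain ⟨p, hp, rfl⟩ := hs
  exact ⟨annuliMap t p, hp, rfl⟩

theorem innerSet_subset_perSet : innerSet σ ⊆ perSet (surfaceFlow σ) := by
  rintro _ ⟨p, hp, rfl⟩
  have hc : 0 < (p.2.2 : ℝ) * (1 - p.2.2) := mul_pos hp.1 (sub_pos.2 hp.2)
  refine ⟨2 * Real.pi / ((p.2.2 : ℝ) * (1 - p.2.2)), by positivity, ?_, fun t ht h => ?_⟩
  · rw [surfaceFlow_proj, annuliMap, rot_period hc]
  · have := proj_injOn_inner σ hp h.symm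
    exact rot_ne_self hc ht p.2.1 (congrArg (fun q : Annuli n => q.2.1) this).symm

theorem corner_mem_singSet (δ : Dart n) : boundaryPoint σ δ 1 ∈ singSet (surfaceFlow σ) := fun t => by
  rw [surfaceFlow_boundaryPoint, rot_zero_one]

theorem omegaSet_arc (δ : Dart n) {u : Circle} (hu : 0 < (u : ℂ).im) :
    omegaSet (surfaceFlow σ) (boundaryPoint σ δ u) = {boundaryPoint σ (σ δ) 1} := by
  refine omegaLimit_singleton_of_tendsto _ ?_
  simp only [surfaceFlow_boundaryPoint]
  rw [← boundaryPoint_neg_one]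
  exact (continuous_boundaryPoint σ δ).continuousAt.tendsto.comp (tendsto_rot_zero_atTop hu)

theorem alphaSet_arc (δ : Dart n) {u : Circle} (hu : 0 < (u : ℂ).im) :
    alphaSet (surfaceFlow σ) (boundaryPoint σ δ u) = {boundaryPoint σ δ 1} := by
  refine omegaLimit_singleton_of_tendsto _ ?_
  simp only [surfaceFlow_boundaryPoint]
  exact (continuous_boundaryPoint σ δ).continuousAt.tendsto.comp (tendsto_rot_zero_atBot hu)

theorem notMem_singSet_of_mem_perSet {S : Type*} [TopologicalSpace S] {v : Flow ℝ S} {x : S}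
    (hx : x ∈ perSet v) : x ∉ singSet v := by
  obtain ⟨T, hT, -, h⟩ := hx
  exact fun hs => h (T / 2) ⟨by linarith, by linarith⟩ (hs _)

theorem arc_notMem_singSet (δ : Dart n) {u : Circle} (hu : 0 < (u : ℂ).im) :
    boundaryPoint σ δ u ∉ singSet (surfaceFlow σ) := by
  intro h
  have h1 : ∀ t, rot 0 t u = u := fun t => by
    have := h t
    rw [surfaceFlow_boundaryPoint, boundaryPoint_arc_eq_iff σ (im_rot_zero_pos hu t) hu] at this
    exact this.2
  have h2 := tendsto_rot_zero_atTop hu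
  simp only [h1] at h2
  rw [tendsto_nhds_unique tendsto_const_nhds h2] at hu
  simp at hu

theorem mem_singSet_iff {s : Surface σ} :
    s ∈ singSet (surfaceFlow σ) ↔ ∃ δ, s = boundaryPoint σ δ 1 := by
  constructor
  · intro h
    rcases surface_cases σ s with hs | ⟨δ, u, hu, rfl⟩ | hs
    · exact absurd h (notMem_singSet_of_mem_perSet (innerSet_subset_perSet σ hs))
    · exact absurd h (arc_notMem_singSet σ δ hu)
    · exact hs
  · rintro ⟨δ, rfl⟩
    exact corner_mem_singSet σ δ

theorem perSet_eq : perSet (surfaceFlow σ) = innerSet σ := by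
  refine Subset.antisymm (fun s hs => ?_) (innerSet_subset_perSet σ)
  rcases surface_cases σ s with h | ⟨δ, u, hu, rfl⟩ | ⟨δ, rfl⟩
  · exact h
  · have := (mem_alphaSet_omegaSet_of_mem_perSet _ hs).1
    rw [alphaSet_arc σ δ hu] at this
    exact absurd this (boundaryPoint_arc_ne_corner σ hu)
  · exact absurd (corner_mem_singSet σ δ) (notMem_singSet_of_mem_perSet hs)

theorem isNonWandering_surfaceFlow : IsNonWandering (surfaceFlow σ) :=
  isNonWandering_of_dense_perSet _ (perSet_eq σ ▸ dense_innerSet σ)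

theorem orbit_arc (δ : Dart n) {u : Circle} (hu : 0 < (u : ℂ).im) :
    (surfaceFlow σ).orbit (boundaryPoint σ δ u) =
      boundaryPoint σ δ '' {w | 0 < (w : ℂ).im} := by
  ext s
  rw [Flow.mem_orbit_iff]
  constructor
  · rintro ⟨t, rfl⟩
    rw [surfaceFlow_boundaryPoint]
    exact ⟨_, im_rot_zero_pos hu t, rfl⟩
  · rintro ⟨w, hw, rfl⟩
    obtain ⟨t, ht⟩ := exists_rot_zero_eq hu hw
    exact ⟨t, by rw [surfaceFlow_boundaryPoint, ht]⟩

theorem exists_circle_im_pos : ∃ u : Circle, 0 < (u : ℂ).im := by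
  obtain ⟨u, -, h⟩ := exists_circle_coe_eq (x := 0) (y := 1) (by norm_num)
  exact ⟨u, by rw [h]; exact one_pos⟩

/-- Only arcs qualify, since a periodic point lies in its own limit set. The preimage under `σ`
appears because the arc of `δ` ends at the corner of `σ δ`. -/
theorem incomingSeparatrices_eq (s : Surface σ) (hs : s ∈ singSet (surfaceFlow σ)) :
    incomingSeparatrices (surfaceFlow σ) s =
      (fun δ => boundaryPoint σ δ '' {w | 0 < (w : ℂ).im}) ''
        (σ ⁻¹' {δ | boundaryPoint σ δ 1 = s}) := by
  ext O
  constructor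
  · rintro ⟨y, hy, hω, rfl⟩
    rcases surface_cases σ y with h | ⟨δ, u, hu, rfl⟩ | ⟨δ, rfl⟩
    · have := (mem_alphaSet_omegaSet_of_mem_perSet _ (innerSet_subset_perSet σ h)).2
      rw [hω, mem_singleton_iff] at this
      exact absurd (this ▸ hs) hy
    · rw [omegaSet_arc σ δ hu, singleton_eq_singleton_iff] at hω
      exact ⟨δ, hω, (orbit_arc σ δ hu).symm⟩
    · exact absurd (corner_mem_singSet σ δ) hy
  · rintro ⟨δ, hδ, rfl⟩
    obtain ⟨u, hu⟩ := exists_circle_im_pos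
    refine ⟨boundaryPoint σ δ u, arc_notMem_singSet σ δ hu, ?_, (orbit_arc σ δ hu).symm⟩
    rw [omegaSet_arc σ δ hu, (show boundaryPoint σ (σ δ) 1 = s from hδ)]

theorem outgoingSeparatrices_eq (s : Surface σ) (hs : s ∈ singSet (surfaceFlow σ)) :
    outgoingSeparatrices (surfaceFlow σ) s =
      (fun δ => boundaryPoint σ δ '' {w | 0 < (w : ℂ).im}) ''
        {δ | boundaryPoint σ δ 1 = s} := by
  ext O
  constructor
  · rintro ⟨y, hy, hω, rfl⟩
    rcases surface_cases σ y with h | ⟨δ, u, hu, rfl⟩ | ⟨δ, rfl⟩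
    · have := (mem_alphaSet_omegaSet_of_mem_perSet _ (innerSet_subset_perSet σ h)).1
      rw [hω, mem_singleton_iff] at this
      exact absurd (this ▸ hs) hy
    · rw [alphaSet_arc σ δ hu, singleton_eq_singleton_iff] at hω
      exact ⟨δ, hω, (orbit_arc σ δ hu).symm⟩
    · exact absurd (corner_mem_singSet σ δ) hy
  · rintro ⟨δ, hδ, rfl⟩
    obtain ⟨u, hu⟩ := exists_circle_im_pos
    refine ⟨boundaryPoint σ δ u, arc_notMem_singSet σ δ hu, ?_, (orbit_arc σ δ hu).symm⟩
    rw [alphaSet_arc σ δ hu, (show boundaryPoint σ δ 1 = s from hδ)]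

theorem arcs_injective : Function.Injective
    fun δ : Dart n => boundaryPoint σ δ '' {w | 0 < (w : ℂ).im} := by
  intro δ δ' h
  obtain ⟨u, hu⟩ := exists_circle_im_pos
  obtain ⟨w, hw, hwu⟩ := (Set.ext_iff.1 h (boundaryPoint σ δ u)).1 ⟨u, hu, rfl⟩
  exact ((boundaryPoint_arc_eq_iff σ hw hu).1 hwu).1.symm

theorem finite_singSet : (singSet (surfaceFlow σ)).Finite :=
  (finite_range fun δ => boundaryPoint σ δ 1).subset fun s hs => by
    obtain ⟨δ, rfl⟩ := (mem_singSet_iff σ).1 hs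
    exact ⟨δ, rfl⟩

theorem isMultiSaddle_iff {s : Surface σ} :
    IsMultiSaddle (surfaceFlow σ) s ↔ s ∈ singSet (surfaceFlow σ) := by
  refine ⟨fun ⟨k, hk⟩ => hk.1, fun hs => ?_⟩
  set B : Set (Dart n) := {δ | boundaryPoint σ δ 1 = s} with hB
  have hBn : B.Nonempty := by
    obtain ⟨δ, rfl⟩ := (mem_singSet_iff σ).1 hs
    exact ⟨δ, rfl⟩
  have hpos : 0 < B.ncard := (ncard_pos (toFinite B)).2 hBn
  -- There are `|B|` outgoing arcs and, `σ` being bijective, `|B|` incoming ones. Since `|B| > 0`,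
  -- the truncated subtraction is exact.
  refine ⟨B.ncard - 1, hs, ⟨(singSet (surfaceFlow σ) \ {s})ᶜ,
    ((finite_singSet σ).subset sdiff_subset).isClosed.isOpen_compl.mem_nhds fun h => h.2 rfl, ?_⟩, ?_⟩
  · ext x
    simp only [mem_inter_iff, mem_compl_iff, Set.mem_sdiff, mem_singleton_iff, not_and, not_not]
    exact ⟨fun h => h.1 h.2, by rintro rfl; exact ⟨fun _ => rfl, hs⟩⟩
  · rw [incomingSeparatrices_eq σ s hs, outgoingSeparatrices_eq σ s hs,
      (arcs_injective σ).encard_image, (arcs_injective σ).encard_image,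
      ← σ.injective.encard_image, image_preimage_eq _ σ.surjective, ← hB,
      ← (toFinite B).cast_ncard_eq]
    norm_cast
    omega

theorem diagram_eq : diagram (surfaceFlow σ) = (innerSet σ)ᶜ := by
  ext s
  simp only [diagram, mem_union, mem_ofPred_eq, mem_compl_iff, isMultiSaddle_iff]
  constructor
  · rintro (hs | ⟨-, p, -, hp, -, hα, -⟩) h
    · exact notMem_singSet_of_mem_perSet (innerSet_subset_perSet σ h) hs
    · have := (mem_alphaSet_omegaSet_of_mem_perSet _ (innerSet_subset_perSet σ h)).1
      rw [hα, mem_singleton_iff] at this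
      exact notMem_singSet_of_mem_perSet (innerSet_subset_perSet σ h) (this ▸ hp)
  · intro h
    rcases surface_cases σ s with hs | ⟨δ, u, hu, rfl⟩ | ⟨δ, rfl⟩
    · exact absurd hs h
    · exact Or.inr ⟨arc_notMem_singSet σ δ hu, _, _, corner_mem_singSet σ _, corner_mem_singSet σ _,
        alphaSet_arc σ δ hu, omegaSet_arc σ δ hu⟩
    · exact Or.inl (corner_mem_singSet σ δ)

/-- The complement of `innerSet` is closed, invariant and without interior. This suffices, as all of
`innerSet` belongs to the edge region anyway. -/
theorem locallyDenseSet_subset : locallyDenseSet (surfaceFlow σ) ⊆ innerSet σ := by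
  intro s hs
  by_contra h
  have hsub : (surfaceFlow σ).orbit s ⊆ (innerSet σ)ᶜ := by
    rintro _ ⟨t, rfl⟩ ht
    refine h ?_
    have := surfaceFlow_mem_innerSet σ ht (-t)
    change surfaceFlow σ (-t) (surfaceFlow σ t s) ∈ _ at this
    rwa [← Flow.map_add, neg_add_cancel, Flow.map_zero_apply] at this
  have hcl := closure_minimal hsub (isOpen_innerSet σ).isClosed_compl
  obtain ⟨y, hy⟩ := hs.mono (interior_mono hcl)
  rw [(dense_innerSet σ).interior_compl] at hy
  exact hy

/-- A radial segment crosses nearby periodic circles once each, on both sides of the given one.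
Composed with a homeomorphism onto `[0, 1)`, it would be a continuous injection with an interior
minimum. -/
theorem not_hasOneSidedNhd {s : Surface σ} (hs : s ∈ innerSet σ) :
    ¬ HasOneSidedNhd (surfaceFlow σ) s := by
  obtain ⟨p, hp, rfl⟩ := hs
  rintro ⟨U, hUo, -, hxU, h, h0⟩
  set γ : ℝ → Annuli n := fun r => (p.1, p.2.1, projIcc (0 : ℝ) 1 zero_le_one r) with hγ
  have hγc : Continuous γ := continuous_const.prodMk (continuous_const.prodMk continuous_projIcc)
  have hγp : γ p.2.2 = p := by
    simp only [hγ]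
    rw [projIcc_val]
  have hγr : ∀ r ∈ Ioo (0 : ℝ) 1, ((γ r).2.2 : ℝ) = r := fun r hr => by
    simp only [hγ]
    rw [projIcc_of_mem zero_le_one (Ioo_subset_Icc_self hr)]
  have hcont : Continuous fun r => proj σ (γ r) := (continuous_proj σ).comp hγc
  have hnhds : (fun r => proj σ (γ r)) ⁻¹' U ∩ Ioo (0 : ℝ) 1 ∈ 𝓝 (p.2.2 : ℝ) :=
    inter_mem (hcont.continuousAt.preimage_mem_nhds (hUo.mem_nhds (by simpa only [hγp] using hxU)))
      (Ioo_mem_nhds hp.1 hp.2)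
  obtain ⟨ε, hε, hball⟩ := Metric.nhds_basis_closedBall.mem_iff.1 hnhds
  rw [Real.closedBall_eq_Icc] at hball
  have hmem : ∀ r (hr : proj σ (γ r) ∈ U),
      orbitProj (surfaceFlow σ) (proj σ (γ r)) ∈ orbitProj (surfaceFlow σ) '' U :=
    fun r hr => mem_image_of_mem _ hr
  classical
  -- The value `0` outside `U` only serves to keep `f` nonnegative everywhere; the argument takes
  -- place inside `U`.
  set f : ℝ → ℝ := fun r => if hr : proj σ (γ r) ∈ U then h ⟨_, hmem r hr⟩ else 0 with hf
  have hfv : ∀ r (hr : proj σ (γ r) ∈ U), f r = h ⟨_, hmem r hr⟩ := fun r hr => dif_pos hr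
  have hf0 : f p.2.2 = 0 := by
    have hpU : proj σ (γ p.2.2) ∈ U := by rwa [hγp]
    have heq : (⟨_, hmem _ hpU⟩ : orbitProj (surfaceFlow σ) '' U) =
        ⟨orbitProj (surfaceFlow σ) (proj σ p), mem_image_of_mem _ hxU⟩ := 
      Subtype.ext (congrArg (fun q => orbitProj (surfaceFlow σ) (proj σ q)) hγp)
    rw [hfv _ hpU, heq, h0]
  have hfpos : ∀ r, 0 ≤ f r := fun r => by
    simp only [hf]
    split_ifs
    · exact (h _).2.1
    · exact le_rfl
  refine not_exists_interior_min_of_injOn (f := f) (a := p.2.2 - ε) (m := p.2.2) (b := p.2.2 + ε)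
    (by linarith) (by linarith) ?_ ?_ (hf0 ▸ hfpos _) (hf0 ▸ hfpos _)
  · rw [continuousOn_iff_continuous_domRestrict]
    have : Continuous fun r : Icc ((p.2.2 : ℝ) - ε) (p.2.2 + ε) =>
        (h ⟨_, hmem r (hball r.2).1⟩ : ℝ) :=
      continuous_subtype_val.comp (h.continuous.comp
        (Continuous.subtype_mk (continuous_quotient_mk'.comp (hcont.comp continuous_subtype_val)) _))
    refine this.congr fun r => ?_
    exact (hfv r (hball r.2).1).symm
  · intro r hr r' hr' heq
    rw [hfv r (hball hr).1, hfv r' (hball hr').1] at heq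
    have h1 := h.injective (Subtype.ext heq)
    have h2 : (surfaceFlow σ).orbit (proj σ (γ r)) = (surfaceFlow σ).orbit (proj σ (γ r')) :=
      Quotient.exact (Subtype.ext_iff.1 h1)
    have h3 := (surfaceFlow σ).mem_orbit_self (proj σ (γ r'))
    rw [← h2, Flow.mem_orbit_iff] at h3
    obtain ⟨t, ht⟩ := h3
    have hr1 := hγr r (hball hr).2
    have h4 := proj_injOn_inner σ (p := annuliMap t (γ r)) (show ((γ r).2.2 : ℝ) ∈ _ by
      rw [hr1]; exact (hball hr).2) ht
    have h5 : ((γ r).2.2 : ℝ) = (γ r').2.2 := by rw [← h4]; rfl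
    rw [← hr1, h5, hγr r' (hball hr').2]

theorem edgeRegion_eq : edgeRegion (surfaceFlow σ) = innerSet σ := by
  refine Subset.antisymm (union_subset (locallyDenseSet_subset σ) ?_) fun s hs => Or.inr ⟨?_, ?_⟩
  · exact sdiff_subset.trans (perSet_eq σ).le
  · exact innerSet_subset_perSet σ hs
  · exact fun h => not_hasOneSidedNhd σ hs h.2

end Dynamics

/-! ### The gluing permutation and the map to the cells -/

section Realization

/-- Each finite fiber carries a cyclic permutation; these are pasted together. -/
theorem exists_perm_sameCycle_iff {α β : Type*} [Finite α] (h : α → β) :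
    ∃ σ : Equiv.Perm α, ∀ a b, σ.SameCycle a b ↔ h a = h b := by
  have hex : ∀ y, ∃ f : Equiv.Perm α, f.IsCycleOn {a | h a = y} := fun y =>
    let ⟨f, hf, _⟩ := (toFinite {a | h a = y}).countable.exists_cycleOn
    ⟨f, hf⟩
  choose f hf using hex
  have hh : ∀ a, h (f (h a) a) = h a := fun a => (hf (h a)).1.mapsTo (show h a = h a from rfl)
  have hinj : Function.Injective fun a => f (h a) a := by
    intro a b hab
    have h1 : h a = h b := by rw [← hh a, ← hh b]; exact congrArg h hab
    simp only [h1] at hab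
    exact (f (h b)).injective hab
  set σ : Equiv.Perm α := Equiv.ofBijective _ (Finite.injective_iff_bijective.1 hinj) with hσ
  have hpow : ∀ (i : ℕ) a, h ((σ ^ i) a) = h a ∧ (σ ^ i) a = (f (h a) ^ i) a := by
    intro i a
    induction i with
    | zero => exact ⟨rfl, rfl⟩
    | succ i ih =>
      rw [pow_succ', pow_succ', Equiv.Perm.mul_apply, Equiv.Perm.mul_apply, ← ih.2]
      have h1 : σ ((σ ^ i) a) = f (h a) ((σ ^ i) a) := by
        conv_rhs => rw [← ih.1]
        rfl
      refine ⟨?_, h1⟩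
      rw [h1]
      conv_lhs => rw [← ih.1]
      rw [hh, ih.1]
  refine ⟨σ, fun a b => ⟨fun hab => ?_, fun hab => ?_⟩⟩
  · obtain ⟨i, rfl⟩ := hab.exists_nat_pow_eq
    exact (hpow i a).1.symm
  · obtain ⟨i, hi⟩ := ((hf (h a)).2 (show h a = h a from rfl) (show h b = h a from hab.symm)).exists_nat_pow_eq
    exact ⟨i, by rw [zpow_natCast, (hpow i a).2, hi]⟩

variable {α β : Type*} {G : Graph α β} {n : ℕ} (σ : Equiv.Perm (Dart n)) (h : Dart n → G.vertexSet)
  (ε : Fin n ≃ G.edgeSet)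

/-- The cell of the graph that a point of the surface lies over. -/
noncomputable def cellMap (s : Surface σ) : Cell G :=
  Quotient.liftOn s (fun p => match label σ p with
    | .inner p => .edge (ε p.1)
    | .arc δ _ => .vertex (h δ)
    | .corner c => .vertex (h c.out)) fun p q hpq => by
      simp only [show label σ p = label σ q from hpq]

variable {σ h}

theorem cellMap_proj {p : Annuli n} (hp : (p.2.2 : ℝ) ∈ Ioo (0 : ℝ) 1) :
    cellMap σ h ε (proj σ p) = .edge (ε p.1) := by
  change (match label σ p with
    | .inner p => Cell.edge (ε p.1)
    | .arc δ _ => .vertex (h δ)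
    | .corner c => .vertex (h c.out)) = _
  rw [label_of_mem_Ioo σ hp]

/-- `h` is constant on cycles of `σ`, hence on those of `σ * σ`, so the representative chosen for a
corner does not matter. -/
theorem cellMap_boundaryPoint (hσ : ∀ δ δ', σ.SameCycle δ δ' ↔ h δ = h δ') (δ : Dart n) (u : Circle) :
    cellMap σ h ε (boundaryPoint σ δ u) = .vertex (h δ) := by
  have hs : ∀ δ, h (σ δ) = h δ := fun δ =>
    ((hσ _ _).1 (Equiv.Perm.sameCycle_apply_right.2 (Equiv.Perm.SameCycle.refl σ δ))).symm
  have hs' : h (σ.symm δ) = h δ := by rw [← hs, Equiv.apply_symm_apply]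
  have hpow : ∀ (i : ℕ) δ, h (((σ * σ) ^ i) δ) = h δ := by
    intro i δ
    induction i with
    | zero => rfl
    | succ i ih => rw [pow_succ', Equiv.Perm.mul_apply, Equiv.Perm.mul_apply, hs, hs, ih]
  have hout : ∀ δ, h (cornerOf σ δ).out = h δ := by
    intro δ
    have : (σ * σ).SameCycle (cornerOf σ δ).out δ := 
      (cornerOf_eq_iff σ).1 (Quotient.out_eq (cornerOf σ δ))
    obtain ⟨i, hi⟩ := this.exists_nat_pow_eq
    exact (hpow i _).symm.trans (congrArg h hi)
  change (match label σ (annulusPoint δ u 0) with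
    | .inner p => Cell.edge (ε p.1)
    | .arc δ _ => .vertex (h δ)
    | .corner c => .vertex (h c.out)) = _
  rw [label_annulusPoint_zero]
  rcases lt_trichotomy (u : ℂ).im 0 with hu | hu | hu
  · rw [boundaryLabel_of_neg σ _ hu]
    simp only [hs']
  · rcases eq_one_or_neg_one_of_im_eq_zero hu with rfl | rfl
    · rw [boundaryLabel_one]
      simp only [hout]
    · rw [boundaryLabel_neg_one]
      simp only [hout, hs]
  · rw [boundaryLabel_of_pos σ _ hu]

end Realization

/-! ### Fibers over the cells, connectedness and conclusion -/

section CellMap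

variable {α β : Type*} {G : Graph α β} {n : ℕ} {σ : Equiv.Perm (Dart n)} {h : Dart n → G.vertexSet}
  (ε : Fin n ≃ G.edgeSet)

theorem cellMap_eq_edge_iff (hσ : ∀ δ δ', σ.SameCycle δ δ' ↔ h δ = h δ') (i : Fin n) :
    cellMap σ h ε ⁻¹' {.edge (ε i)} = proj σ '' {p | p.1 = i ∧ (p.2.2 : ℝ) ∈ Ioo (0 : ℝ) 1} := by
  ext s
  constructor
  · intro hs
    rcases mem_innerSet_or_exists_boundaryPoint σ s with ⟨p, hp, rfl⟩ | ⟨δ, u, rfl⟩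
    · rw [mem_preimage, cellMap_proj ε hp, mem_singleton_iff, Cell.edge.injEq,
        EmbeddingLike.apply_eq_iff_eq] at hs
      exact ⟨p, ⟨hs, hp⟩, rfl⟩
    · rw [mem_preimage, cellMap_boundaryPoint ε hσ] at hs
      cases hs
  · rintro ⟨p, ⟨rfl, hp⟩, rfl⟩
    exact cellMap_proj ε hp

theorem cellMap_eq_vertex_iff (hσ : ∀ δ δ', σ.SameCycle δ δ' ↔ h δ = h δ') (x : G.vertexSet) :
    cellMap σ h ε ⁻¹' {.vertex x} = ⋃ δ ∈ {δ | h δ = x}, range (boundaryPoint σ δ) := by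
  ext s
  simp only [mem_iUnion, mem_preimage, mem_singleton_iff, mem_ofPred_eq]
  constructor
  · intro hs
    rcases mem_innerSet_or_exists_boundaryPoint σ s with ⟨p, hp, rfl⟩ | ⟨δ, u, rfl⟩
    · rw [cellMap_proj ε hp] at hs
      cases hs
    · rw [cellMap_boundaryPoint ε hσ, Cell.vertex.injEq] at hs
      exact ⟨δ, hs, u, rfl⟩
  · rintro ⟨δ, rfl, u, rfl⟩
    exact cellMap_boundaryPoint ε hσ δ u

theorem isClosed_cellMap_vertex (hσ : ∀ δ δ', σ.SameCycle δ δ' ↔ h δ = h δ') (x : G.vertexSet) :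
    IsClosed (cellMap σ h ε ⁻¹' {.vertex x}) := by
  rw [cellMap_eq_vertex_iff ε hσ]
  exact (toFinite _).isClosed_biUnion fun δ _ => (isCompact_range (continuous_boundaryPoint σ δ)).isClosed

/-- Consecutive circles of a cycle of `σ` share a corner: `-1` on one is `1` on the next. -/
theorem isPreconnected_cellMap_vertex (hσ : ∀ δ δ', σ.SameCycle δ δ' ↔ h δ = h δ')
    (x : G.vertexSet) : IsPreconnected (cellMap σ h ε ⁻¹' {.vertex x}) := by
  rw [cellMap_eq_vertex_iff ε hσ]
  refine IsPreconnected.biUnion_of_reflTransGen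
    (fun δ _ => isPreconnected_range (continuous_boundaryPoint σ δ)) ?_
  rintro δ rfl δ' (hδ' : h δ' = h δ)
  obtain ⟨i, rfl⟩ := ((hσ δ δ').2 hδ'.symm).exists_nat_pow_eq
  have hmem : ∀ i : ℕ, h ((σ ^ i) δ) = h δ := fun i => ((hσ _ _).1 ⟨i, rfl⟩).symm
  clear hδ'
  induction i with
  | zero => exact Relation.ReflTransGen.refl
  | succ i ih =>
    refine ih.tail ⟨⟨boundaryPoint σ ((σ ^ i) δ) (-1), ⟨_, rfl⟩, 1, ?_⟩, hmem i⟩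
    rw [boundaryPoint_neg_one, pow_succ', Equiv.Perm.mul_apply]

theorem isOpen_cellMap_edge (hσ : ∀ δ δ', σ.SameCycle δ δ' ↔ h δ = h δ') (e : G.edgeSet) :
    IsOpen (cellMap σ h ε ⁻¹' {.edge e}) := by
  obtain ⟨i, rfl⟩ := ε.surjective e
  rw [cellMap_eq_edge_iff ε hσ, ← (isQuotientMap_proj σ).isOpen_preimage]
  have : proj σ ⁻¹' (proj σ '' {p | p.1 = i ∧ (p.2.2 : ℝ) ∈ Ioo (0 : ℝ) 1}) =
      {p | p.1 = i ∧ (p.2.2 : ℝ) ∈ Ioo (0 : ℝ) 1} := by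
    refine Subset.antisymm ?_ (subset_preimage_image _ _)
    rintro p ⟨q, hq, hqp⟩
    exact proj_injOn_inner σ hq.2 hqp ▸ hq
  rw [this]
  exact ((isOpen_discrete {i}).preimage continuous_fst).inter (isOpen_Ioo.preimage (by fun_prop))

theorem isPreconnected_cellMap_edge (hσ : ∀ δ δ', σ.SameCycle δ δ' ↔ h δ = h δ') (e : G.edgeSet) :
    IsPreconnected (cellMap σ h ε ⁻¹' {.edge e}) := by
  obtain ⟨i, rfl⟩ := ε.surjective e
  rw [cellMap_eq_edge_iff ε hσ]
  have hc : Continuous fun x : Circle × ℝ => proj σ (i, x.1, projIcc (0 : ℝ) 1 zero_le_one x.2) :=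
    (continuous_proj σ).comp (continuous_const.prodMk (continuous_fst.prodMk
      (continuous_projIcc.comp continuous_snd)))
  convert (isPreconnected_univ.prod (isPreconnected_Ioo (a := (0 : ℝ)) (b := 1))).image _
    hc.continuousOn using 1
  ext s
  constructor
  · rintro ⟨⟨j, u, r⟩, ⟨rfl, hr⟩, rfl⟩
    refine ⟨(u, r), ⟨mem_univ _, hr⟩, ?_⟩
    simp only [projIcc_val]
  · rintro ⟨⟨u, r⟩, ⟨-, hr⟩, rfl⟩
    refine ⟨_, ⟨rfl, ?_⟩, rfl⟩
    simp only
    rwa [projIcc_of_mem zero_le_one (Ioo_subset_Icc_self hr)]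

theorem isRealizedBy_surfaceFlow (hV : G.vertexSet.Finite)
    (hσ : ∀ δ δ', σ.SameCycle δ δ' ↔ h δ = h δ')
    (hends : ∀ i, G.IsLink (ε i).1 (h (i, false)).1 (h (i, true)).1)
    (hsurj : Function.Surjective h) : IsRealizedBy G (surfaceFlow σ) := by
  have hinc : ∀ δ : Dart n, G.Inc (ε δ.1).1 (h δ).1 := by
    rintro ⟨i, _ | _⟩
    · exact (hends i).inc_left
    · exact (hends i).inc_right
  have hcl : ∀ e x, G.Inc e.1 x.1 →
      (cellMap σ h ε ⁻¹' {.vertex x} ∩ closure (cellMap σ h ε ⁻¹' {.edge e})).Nonempty := by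
    intro e x hex
    obtain ⟨i, rfl⟩ := ε.surjective e
    obtain ⟨b, hb⟩ : ∃ b, x = h (i, b) := by
      rcases hex.eq_or_eq_of_isLink (hends i) with h1 | h1
      · exact ⟨false, Subtype.ext h1⟩
      · exact ⟨true, Subtype.ext h1⟩
    refine ⟨boundaryPoint σ (i, b) 1, ?_, ?_⟩
    · rw [mem_preimage, cellMap_boundaryPoint ε hσ, hb]
      rfl
    · rw [cellMap_eq_edge_iff ε hσ]
      exact boundaryPoint_mem_closure σ (i, b) 1
  have hmem : ∀ s, s ∈ innerSet σ ↔ ∃ e, cellMap σ h ε s = .edge e := by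
    intro s
    rcases mem_innerSet_or_exists_boundaryPoint σ s with hs | ⟨δ, u, rfl⟩
    · refine iff_of_true hs ?_
      obtain ⟨p, hp, rfl⟩ := hs
      exact ⟨_, cellMap_proj ε hp⟩
    · refine iff_of_false (boundaryPoint_notMem_innerSet σ δ u) ?_
      rintro ⟨e, he⟩
      rw [cellMap_boundaryPoint ε hσ] at he
      cases he
  refine isRealizedBy_of_map (c := cellMap σ h ε) hV ?_ ?_ ?_ ?_ (isClosed_cellMap_vertex ε hσ)
    (isPreconnected_cellMap_vertex ε hσ) (isOpen_cellMap_edge ε hσ)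
    (isPreconnected_cellMap_edge ε hσ) hcl ?_
  · rintro (x | e)
    · obtain ⟨δ, rfl⟩ := hsurj x
      exact ⟨_, cellMap_boundaryPoint ε hσ δ 1⟩
    · obtain ⟨i, rfl⟩ := ε.surjective e
      exact ⟨proj σ (i, 1, ⟨1 / 2, by norm_num, by norm_num⟩),
        cellMap_proj ε ⟨by norm_num, by norm_num⟩⟩
  · intro s
    rw [diagram_eq, mem_compl_iff, hmem]
    cases cellMap σ h ε s <;> simp
  · intro s
    rw [edgeRegion_eq, hmem]
  · intro t s
    rcases mem_innerSet_or_exists_boundaryPoint σ s with ⟨p, hp, rfl⟩ | ⟨δ, u, rfl⟩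
    · rw [surfaceFlow_proj, cellMap_proj ε hp, cellMap_proj ε (p := annuliMap t p) hp]
      rfl
    · rw [surfaceFlow_boundaryPoint, cellMap_boundaryPoint ε hσ, cellMap_boundaryPoint ε hσ]
  · intro e
    obtain ⟨i, rfl⟩ := ε.surjective e
    have : Finite G.vertexSet := hV
    -- The closed annulus alone is not a union of fibers; adding the full fibers over its ends,
    -- finitely many closed sets, repairs this.
    have heq : cellMap σ h ε ⁻¹' {a | a ≤ .edge (ε i)} = proj σ '' {p | p.1 = i} ∪
        ⋃ x ∈ {x : G.vertexSet | G.Inc (ε i).1 x.1}, cellMap σ h ε ⁻¹' {.vertex x} := by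
      ext s
      constructor
      · intro hs
        have hs : CellLE G (cellMap σ h ε s) (.edge (ε i)) := hs
        generalize ha : cellMap σ h ε s = a at hs
        cases hs with
        | refl =>
          have hs' : s ∈ cellMap σ h ε ⁻¹' {.edge (ε i)} := ha
          rw [cellMap_eq_edge_iff ε hσ] at hs'
          exact Or.inl (image_mono (fun p hp => hp.1) hs')
        | inc x _ hx => exact Or.inr (mem_biUnion (show x ∈ {x | _} from hx) ha)
      · rintro (⟨p, rfl, rfl⟩ | hs)
        · rcases exists_annulusPoint_zero_or p with ⟨δ, u, rfl⟩ | hp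
          · exact (congrArg (· ≤ _) (cellMap_boundaryPoint ε hσ δ u)).mpr
              (CellLE.inc _ _ (hinc δ))
          · exact (cellMap_proj ε hp).le
        · obtain ⟨x, hx, hs⟩ := mem_iUnion₂.1 hs
          exact (congrArg (· ≤ _) (show cellMap σ h ε s = .vertex x from hs)).mpr
            (CellLE.inc _ _ hx)
    rw [heq]
    exact (isClosedMap_proj σ _ ((isClosed_discrete {i}).preimage continuous_fst)).union
      ((toFinite _).isClosed_biUnion fun x _ => isClosed_cellMap_vertex ε hσ x)

/-- A walk in the graph lifts to the surface: an edge is traversed across its annulus, and at a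
vertex the connected fiber leads from one boundary circle to another. -/
theorem connectedSpace_surface (hσ : ∀ δ δ', σ.SameCycle δ δ' ↔ h δ = h δ')
    (hends : ∀ i, G.IsLink (ε i).1 (h (i, false)).1 (h (i, true)).1)
    (hsurj : Function.Surjective h) (hconn : GraphConnected G) : ConnectedSpace (Surface σ) := by
  obtain ⟨⟨x₀, hx₀⟩, hconn⟩ := hconn
  obtain ⟨δ₀, hδ₀⟩ := hsurj ⟨x₀, hx₀⟩
  set C := connectedComponent (boundaryPoint σ δ₀ 1)
  have hextend : ∀ {A : Set (Surface σ)} {a b : Surface σ}, IsPreconnected A → a ∈ A → a ∈ C →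
      b ∈ A → b ∈ C := fun {A a b} hA ha haC hb => by
    rw [show C = connectedComponent a from connectedComponent_eq haC]
    exact hA.subset_connectedComponent ha hb
  have hvertex : ∀ {δ δ' : Dart n} {u u' : Circle}, h δ = h δ' → boundaryPoint σ δ u ∈ C →
      boundaryPoint σ δ' u' ∈ C := fun {δ δ' u u'} hδ hC =>
    hextend (isPreconnected_cellMap_vertex ε hσ (h δ)) (cellMap_boundaryPoint ε hσ δ u) hC
      ((cellMap_boundaryPoint ε hσ δ' u').trans (by rw [hδ]))
  have hann : ∀ i : Fin n, IsPreconnected (proj σ '' {p | p.1 = i}) := fun i => by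
    have hc : Continuous fun x : Circle × unitInterval => proj σ (i, x.1, x.2) :=
      (continuous_proj σ).comp (by fun_prop)
    convert isPreconnected_range hc using 1
    ext s
    constructor
    · rintro ⟨p, rfl, rfl⟩
      exact ⟨p.2, rfl⟩
    · rintro ⟨x, rfl⟩
      exact ⟨_, rfl, rfl⟩
  have hall : ∀ x, Relation.ReflTransGen G.Adj x₀ x → ∀ δ u, (h δ).1 = x →
      boundaryPoint σ δ u ∈ C := by
    intro x hx
    induction hx with
    | refl =>
      intro δ u hδ
      exact hvertex (hδ₀.trans (Subtype.ext hδ.symm)) mem_connectedComponent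
    | @tail y z _ hyz ih =>
      obtain ⟨e, he⟩ := hyz
      obtain ⟨i, hi⟩ := ε.surjective ⟨e, he.edge_mem⟩
      have hl := hends i
      rw [hi] at hl
      obtain ⟨b, hb, hb'⟩ : ∃ b, (h (i, b)).1 = y ∧ (h (i, !b)).1 = z := by
        rcases hl.eq_and_eq_or_eq_and_eq he with h1 | h1
        · exact ⟨false, h1⟩
        · exact ⟨true, h1.2, h1.1⟩
      intro δ u hδ
      refine hvertex (δ := (i, !b)) (u := 1) (Subtype.ext (hb'.trans hδ.symm)) ?_
      exact hextend (hann i) ⟨_, rfl, rfl⟩ (ih (i, b) 1 hb) ⟨_, rfl, rfl⟩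
  have huniv : C = univ := by
    refine eq_univ_of_forall fun s => ?_
    obtain ⟨p, rfl⟩ := proj_surjective σ s
    exact hextend (hann p.1) 
      (a := boundaryPoint σ (p.1, false) 1) ⟨annulusPoint (p.1, false) 1 0, rfl, rfl⟩
      (hall _ (hconn x₀ hx₀ _ (h (p.1, false)).2) _ _ rfl) ⟨p, rfl, rfl⟩
  exact { isPreconnected_univ := huniv ▸ isPreconnected_connectedComponent
          toNonempty := ⟨boundaryPoint σ δ₀ 1⟩ }

/-- The first step of a walk to another vertex, or, if there is none, an edge that is then a loop.
Without it a vertex might have no boundary circle to represent it. -/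
theorem exists_isLink_of_connected (hconn : GraphConnected G) (hnt : ¬ GraphTrivial G) {x : α}
    (hx : x ∈ G.vertexSet) : ∃ e y, G.IsLink e x y := by
  by_cases hy : ∃ y ∈ G.vertexSet, y ≠ x
  · obtain ⟨y, hy, hyx⟩ := hy
    rcases (hconn.2 x hx y hy).cases_head with h | ⟨z, ⟨e, he⟩, -⟩
    · exact absurd h.symm hyx
    · exact ⟨e, z, he⟩
  · push Not at hy
    have hV : G.vertexSet = {x} := Subset.antisymm hy (singleton_subset_iff.2 hx)
    obtain ⟨e, he⟩ := nonempty_iff_ne_empty.2 fun h => hnt ⟨⟨x, hV⟩, h⟩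
    obtain ⟨y, z, hl⟩ := G.exists_isLink_of_mem_edgeSet he
    have := hy y hl.left_mem
    exact ⟨e, z, this ▸ hl⟩

end CellMap

end SurfaceFlow

theorem mainTheorem8 {α β : Type*} (G : Graph α β)
    (hV : G.vertexSet.Finite) (hE : G.edgeSet.Finite)
    (hconn : SurfaceFlow.GraphConnected G) (hnt : ¬ SurfaceFlow.GraphTrivial G) :
    ∃ (S : Type) (_ : TopologicalSpace S) (v : Flow ℝ S),
      SurfaceFlow.IsClosedSurface S ∧ ConnectedSpace S ∧
      SurfaceFlow.IsNonWandering v ∧ SurfaceFlow.IsRealizedBy G v := by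
  have : Finite G.edgeSet := hE
  obtain ⟨n, ⟨ε⟩⟩ := Finite.exists_equiv_fin G.edgeSet
  choose x y hxy using fun e : G.edgeSet => G.exists_isLink_of_mem_edgeSet e.2
  -- The two ends of an edge are ordered arbitrarily; a loop sends both darts to one vertex.
  let h : SurfaceFlow.Dart n → G.vertexSet := fun δ =>
    if δ.2 then ⟨y (ε.symm δ.1), (hxy _).right_mem⟩ else ⟨x (ε.symm δ.1), (hxy _).left_mem⟩
  have hends : ∀ i, G.IsLink (ε.symm i).1 (h (i, false)).1 (h (i, true)).1 :=
    fun i => hxy (ε.symm i)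
  have hsurj : Function.Surjective h := by
    rintro ⟨z, hz⟩
    obtain ⟨e, w, he⟩ := SurfaceFlow.exists_isLink_of_connected hconn hnt hz
    have hl := hends (ε ⟨e, he.edge_mem⟩)
    rw [Equiv.symm_apply_apply] at hl
    rcases he.left_eq_or_eq hl with h1 | h1
    · exact ⟨_, Subtype.ext h1.symm⟩
    · exact ⟨_, Subtype.ext h1.symm⟩
  obtain ⟨σ, hσ⟩ := SurfaceFlow.exists_perm_sameCycle_iff h
  exact ⟨SurfaceFlow.Surface σ, inferInstance, SurfaceFlow.surfaceFlow σ,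
    SurfaceFlow.isClosedSurface_surface σ,
    SurfaceFlow.connectedSpace_surface ε.symm hσ hends hsurj hconn,
    SurfaceFlow.isNonWandering_surfaceFlow σ,
    SurfaceFlow.isRealizedBy_surfaceFlow ε.symm hV hσ hends hsurj⟩
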